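/- Let $n\ge 2$, $W=S_n$ acting on $\mathfrak h=\mathbb C^n$ by permuting coordinates, $x_1,\dots,x_n$ the coordinate functions, $y_1,\dots,y_n$ the dual basis of $\mathfrak h$, $\delta=\prod_{i<j}(x_i-x_j)$, $\mathfrak h^{\rm reg}=\mathfrak h\smallsetminus\delta^{-1}(0)$, and let $\mathsf H^{\rm reg}=\mathscr D(\mathfrak h^{\rm reg})\ast W$ be the skew group ring of $W$ over the ring of differential operators on $\mathfrak h^{\rm reg}$ (so $wD=(w\cdot D)w$). For $c\in\mathbb C$ let $\mathsf H_c\subset\mathsf H^{\rm reg}$ be the rational Cherednik algebra, i.e. the subalgebra generated by $W$, $x_1,\dots,x_n$ and the Dunkl operators $$D_c(y_i)=\frac{\partial}{\partial x_i}-\frac12\sum_{j\ne k}c\,\frac{\langle y_i,x_j-x_k\rangle}{x_j-x_k}(1-s_{jk}),\qquad 1\le i\le n,$$ where $s_{jk}\in W$ is the transposition of $j$ and $k$. Let $e=\frac1{|W|}\sum_{w\in W}w$, $\mathsf U_c=e\mathsf H_ce$ and $\mathsf U^{\rm reg}=\mathsf U_c[\delta^{-2}]=e\,\mathsf H^{\rm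 reg}e$ (independent of $c$). Put $P_{a-1}^{a}=e\mathsf H_a\delta e$ and $Q_{a}^{a-1}=e\delta^{-1}\mathsf H_ae$, and inductively, for $a\in b+\mathbb Z_{\ge2}$, $P_b^a=P_{a-1}^{a}\cdot P_{b}^{a-1}$ and $Q_a^b=Q_{b+1}^{b}\cdot Q_{a}^{b+1}$, where the product of two subspaces of $\mathsf H^{\rm reg}$ is the span of the products of their elements. For each $c\in\mathbb C$ there is a unique $\mathbb C$-algebra endomorphism $\phi_c$ of $\mathsf H^{\rm reg}$ with $\phi_c(p)=p$ for $p\in\mathbb C[\mathfrak h]$, $\phi_c(D_c(y_i))=D_{-c}(y_i)$ for $1\le i\le n$, and $\phi_c(w)=\operatorname{sign}(w)\,w$ for $w\in W$. It is an automorphism of $\mathsf H^{\rm reg}$ and maps $\mathsf H_c$ onto $\mathsf H_{-c}$. Moreover, for every $c\in\mathbb C$: 1. $\phi_{c+1}(z)=\delta^{-2}\phi_c(z)\delta^2$ for all $z\in\mathsf U^{\rm reg}$. 2. $\phi_{c+1}(\mathsf U_c)=\delta^{-1}\,\mathsf U_{-c-1}\,\delta$. 3. $\phi_{c+1}(P_{c}^{c+j})=\delta^{2j-1}\,Q_{-c-1}^{-c-j-1}\,\delta$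 for all integers $j>0$. -/

import Mathlib

noncomputable section

namespace Cherednik

/-- The discriminant `δ = ∏_{i < j} (x_i - x_j)` in `ℂ[𝔥]`, where `𝔥 = ℂⁿ`. -/
def disc (n : ℕ) : MvPolynomial (Fin n) ℂ :=
  ∏ i : Fin n, ∏ j ∈ Finset.Ioi i, (MvPolynomial.X i - MvPolynomial.X j)

/-- The coordinate ring `ℂ[𝔥ʳᵉᵍ] = ℂ[𝔥][δ⁻¹]` of the regular locus of `𝔥 = ℂⁿ`. -/
def RegFun (n : ℕ) : Type := Localization.Away (disc n)

instance (n : ℕ) : CommRing (RegFun n) :=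
  inferInstanceAs (CommRing (Localization.Away (disc n)))

instance (n : ℕ) : Algebra (MvPolynomial (Fin n) ℂ) (RegFun n) :=
  inferInstanceAs (Algebra (MvPolynomial (Fin n) ℂ) (Localization.Away (disc n)))

instance (n : ℕ) : Algebra ℂ (RegFun n) :=
  inferInstanceAs (Algebra ℂ (Localization.Away (disc n)))

instance (n : ℕ) : IsScalarTower ℂ (MvPolynomial (Fin n) ℂ) (RegFun n) :=
  inferInstanceAs (IsScalarTower ℂ (MvPolynomial (Fin n) ℂ) (Localization.Away (disc n)))

instance (n : ℕ) : IsLocalization.Away (disc n) (RegFun n) :=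
  inferInstanceAs (IsLocalization.Away (disc n) (Localization.Away (disc n)))

/-- The coordinate function `x_i`, as an element of `ℂ[𝔥ʳᵉᵍ]`. -/
def coord (n : ℕ) (i : Fin n) : RegFun n :=
  algebraMap (MvPolynomial (Fin n) ℂ) (RegFun n) (MvPolynomial.X i)

theorem isUnit_disc (n : ℕ) :
    IsUnit (algebraMap (MvPolynomial (Fin n) ℂ) (RegFun n) (disc n)) :=
  IsLocalization.Away.algebraMap_isUnit (disc n)

/-- The discriminant as a unit of `ℂ[𝔥ʳᵉᵍ]`. -/
def discUnit (n : ℕ) : (RegFun n)ˣ := (isUnit_disc n).unit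

/-- The functions `x_i - x_j` with `i ≠ j` are invertible on `𝔥ʳᵉᵍ`. -/
theorem isUnit_coord_sub (n : ℕ) {i j : Fin n} (h : i ≠ j) :
    IsUnit (coord n i - coord n j) := by
  have key : ∀ a b : Fin n, a < b → IsUnit (coord n a - coord n b) := by
    intro a b hab
    refine isUnit_of_dvd_unit ?_ (isUnit_disc n)
    have h1 : (MvPolynomial.X a - MvPolynomial.X b : MvPolynomial (Fin n) ℂ) ∣ disc n :=
      (Finset.dvd_prod_of_mem (fun j => (MvPolynomial.X a - MvPolynomial.X j :
        MvPolynomial (Fin n) ℂ)) (Finset.mem_Ioi.2 hab)).trans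
        (Finset.dvd_prod_of_mem (fun i => ∏ j ∈ Finset.Ioi i,
          (MvPolynomial.X i - MvPolynomial.X j : MvPolynomial (Fin n) ℂ)) (Finset.mem_univ a))
    have h2 := map_dvd (algebraMap (MvPolynomial (Fin n) ℂ) (RegFun n)) h1
    rwa [map_sub] at h2
  rcases lt_or_gt_of_ne h with h | h
  · exact key i j h
  · rw [← neg_sub]
    exact (key j i h).neg

theorem isUnit_rename_disc (n : ℕ) (w : Equiv.Perm (Fin n)) :
    IsUnit (((IsScalarTower.toAlgHom ℂ (MvPolynomial (Fin n) ℂ) (RegFun n)).comp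
      (MvPolynomial.rename w)) (disc n)) := by
  simp only [disc, map_prod]
  refine IsUnit.prod_univ_iff.2 fun i => ?_
  refine IsUnit.prod_iff.2 fun j hj => ?_
  have : i ≠ j := (Finset.mem_Ioi.1 hj).ne
  have h := isUnit_coord_sub n (w.injective.ne this)
  rw [map_sub, AlgHom.comp_apply, AlgHom.comp_apply, MvPolynomial.rename_X, MvPolynomial.rename_X]
  exact h

/-- The action of `w ∈ W = S_n` on `ℂ[𝔥ʳᵉᵍ]`, `(w·f)(z) = f(w⁻¹·z)`. Since `w` permutes the
standard basis of `𝔥 = ℂⁿ`, this is the algebra map with `w·x_i = x_{w(i)}`. -/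
def permHom (n : ℕ) (w : Equiv.Perm (Fin n)) : RegFun n →ₐ[ℂ] RegFun n :=
  IsLocalization.Away.liftAlgHom (disc n)
    (f := (IsScalarTower.toAlgHom ℂ (MvPolynomial (Fin n) ℂ) (RegFun n)).comp (MvPolynomial.rename w))
    (isUnit_rename_disc n w)

theorem permHom_coord (n : ℕ) (w : Equiv.Perm (Fin n)) (i : Fin n) :
    permHom n w (coord n i) = coord n (w i) := by
  simp only [permHom, coord, IsLocalization.Away.liftAlgHom_apply, IsLocalization.Away.lift_eq]
  simp

/-- Two algebra maps out of `ℂ[𝔥ʳᵉᵍ]` that agree on the coordinates are equal. -/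
theorem regFun_algHom_ext {n : ℕ} {B : Type*} [CommRing B] [Algebra ℂ B]
    {f g : RegFun n →ₐ[ℂ] B} (h : ∀ i, f (coord n i) = g (coord n i)) : f = g := by
  refine IsLocalization.algHom_ext (Submonoid.powers (disc n)) ?_
  refine MvPolynomial.algHom_ext fun i => ?_
  exact h i

theorem permHom_one (n : ℕ) : permHom n 1 = AlgHom.id ℂ (RegFun n) :=
  regFun_algHom_ext fun i => by simp [permHom_coord]

theorem permHom_mul (n : ℕ) (v w : Equiv.Perm (Fin n)) :
    permHom n (v * w) = (permHom n v).comp (permHom n w) :=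
  regFun_algHom_ext fun i => by simp [permHom_coord]

/-- The ring of differential operators of a commutative `ℂ`-algebra `R` that is the coordinate
ring of a smooth affine variety `X`: the algebra of `ℂ`-linear endomorphisms of `R` generated by
multiplications by functions and by the vector fields (derivations) on `X`. -/
def diffOps (R : Type*) [CommRing R] [Algebra ℂ R] : Subalgebra ℂ (Module.End ℂ R) :=
  Algebra.adjoin ℂ
    (Set.range (fun f : R => LinearMap.mulLeft ℂ f) ∪
      Set.range (fun d : Derivation ℂ R R => (d : R →ₗ[ℂ] R)))

/-- `𝒟(𝔥ʳᵉᵍ)`. -/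
def DReg (n : ℕ) : Type := diffOps (RegFun n)

instance (n : ℕ) : Ring (DReg n) := inferInstanceAs (Ring (diffOps (RegFun n)))

instance (n : ℕ) : Algebra ℂ (DReg n) := inferInstanceAs (Algebra ℂ (diffOps (RegFun n)))

/-- A function on `𝔥ʳᵉᵍ` as a differential operator. -/
def DReg.ofFun {n : ℕ} (f : RegFun n) : DReg n :=
  ⟨LinearMap.mulLeft ℂ f, Algebra.subset_adjoin (Or.inl ⟨f, rfl⟩)⟩

/-- A vector field on `𝔥ʳᵉᵍ` as a differential operator. -/
def DReg.ofDer {n : ℕ} (d : Derivation ℂ (RegFun n) (RegFun n)) : DReg n :=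
  ⟨(d : RegFun n →ₗ[ℂ] RegFun n), Algebra.subset_adjoin (Or.inr ⟨d, rfl⟩)⟩

theorem permHom_inv_apply (n : ℕ) (w : Equiv.Perm (Fin n)) (f : RegFun n) :
    permHom n w (permHom n w⁻¹ f) = f := by
  have h := permHom_mul n w w⁻¹
  rw [mul_inv_cancel, permHom_one] at h
  exact (DFunLike.congr_fun h f).symm

theorem permHom_inv_apply' (n : ℕ) (w : Equiv.Perm (Fin n)) (f : RegFun n) :
    permHom n w⁻¹ (permHom n w f) = f := by
  simpa using permHom_inv_apply n w⁻¹ f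

/-- The action of `w ∈ W` on linear endomorphisms of `ℂ[𝔥ʳᵉᵍ]`, `(w·θ)(f) = w·(θ(w⁻¹·f))`. -/
def conjHom (n : ℕ) (w : Equiv.Perm (Fin n)) :
    Module.End ℂ (RegFun n) →ₐ[ℂ] Module.End ℂ (RegFun n) where
  toFun θ := (permHom n w).toLinearMap ∘ₗ θ ∘ₗ (permHom n w⁻¹).toLinearMap
  map_one' := by ext f; simp [permHom_inv_apply]
  map_mul' θ η := by ext f; simp [permHom_inv_apply']
  map_zero' := by ext f; simp
  map_add' θ η := by ext f; simp
  commutes' c := by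
    ext f
    simp [Module.algebraMap_end_apply, permHom_inv_apply]

theorem conjHom_apply (n : ℕ) (w : Equiv.Perm (Fin n)) (θ : Module.End ℂ (RegFun n))
    (f : RegFun n) : conjHom n w θ f = permHom n w (θ (permHom n w⁻¹ f)) := rfl

theorem conjHom_mem (n : ℕ) (w : Equiv.Perm (Fin n)) (θ : Module.End ℂ (RegFun n))
    (hθ : θ ∈ diffOps (RegFun n)) : conjHom n w θ ∈ diffOps (RegFun n) := by
  have h : diffOps (RegFun n) ≤ (diffOps (RegFun n)).comap (conjHom n w) := by
    refine Algebra.adjoin_le ?_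
    rintro _ (⟨f, rfl⟩ | ⟨d, rfl⟩)
    · refine Algebra.subset_adjoin (Or.inl ⟨permHom n w f, ?_⟩)
      ext g
      simp [conjHom_apply, permHom_inv_apply]
    · refine Algebra.subset_adjoin (Or.inr ⟨Derivation.mk' (conjHom n w d) ?_, ?_⟩)
      · intro a b
        simp [conjHom_apply, permHom_inv_apply]
      · ext g
        rfl
  exact h hθ

/-- The induced action of `W = S_n` on `𝒟(𝔥ʳᵉᵍ)` by algebra automorphisms. -/
instance instActionDReg (n : ℕ) : MulSemiringAction (Equiv.Perm (Fin n)) (DReg n) where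
  smul w θ := ⟨conjHom n w θ.1, conjHom_mem n w θ.1 θ.2⟩
  one_smul θ := by
    refine Subtype.ext (LinearMap.ext fun f => ?_)
    change permHom n 1 (θ.1 (permHom n 1⁻¹ f)) = θ.1 f
    simp [permHom_one]
  mul_smul v w θ := by
    refine Subtype.ext (LinearMap.ext fun f => ?_)
    change permHom n (v * w) (θ.1 (permHom n (v * w)⁻¹ f)) =
      permHom n v (permHom n w (θ.1 (permHom n w⁻¹ (permHom n v⁻¹ f))))
    simp [permHom_mul]
  smul_zero w := Subtype.ext (map_zero (conjHom n w))
  smul_add w θ η := Subtype.ext (map_add (conjHom n w) θ.1 η.1)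
  smul_one w := Subtype.ext (map_one (conjHom n w))
  smul_mul w θ η := Subtype.ext (map_mul (conjHom n w) θ.1 η.1)

instance instSMulCommDReg (n : ℕ) : SMulCommClass (Equiv.Perm (Fin n)) ℂ (DReg n) where
  smul_comm w c θ := Subtype.ext (map_smul (conjHom n w) c θ.1 :)

/-- The skew group ring `𝒟(𝔥ʳᵉᵍ) ∗ W`, with multiplication `w D = (w·D) w`. It is the
localised Cherednik algebra `Hʳᵉᵍ = H_c[δ⁻¹]`. -/
abbrev HReg (n : ℕ) : Type := SkewMonoidAlgebra (DReg n) (Equiv.Perm (Fin n))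

/-- A differential operator as an element of `𝒟(𝔥ʳᵉᵍ) ∗ W`. -/
def op {n : ℕ} (D : DReg n) : HReg n := SkewMonoidAlgebra.single 1 D

/-- A function on `𝔥ʳᵉᵍ` as an element of `𝒟(𝔥ʳᵉᵍ) ∗ W`. -/
def fn {n : ℕ} (f : RegFun n) : HReg n := op (DReg.ofFun f)

/-- A permutation as an element of `𝒟(𝔥ʳᵉᵍ) ∗ W`. -/
def perm {n : ℕ} (w : Equiv.Perm (Fin n)) : HReg n := SkewMonoidAlgebra.single w 1

/-- The power `δ^k`, `k ∈ ℤ`, of the discriminant in `𝒟(𝔥ʳᵉᵍ) ∗ W`. -/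
def discPow (n : ℕ) (k : ℤ) : HReg n := fn (((discUnit n) ^ k : (RegFun n)ˣ) : RegFun n)

/-- The map `ℂ[𝔥] → ℂ[𝔥ʳᵉᵍ][ε]`, `p ↦ p + ε ∂p/∂x_i`. -/
def dualHom (n : ℕ) (i : Fin n) :
    MvPolynomial (Fin n) ℂ →ₐ[ℂ] TrivSqZeroExt (RegFun n) (RegFun n) :=
  MvPolynomial.aeval fun k =>
    TrivSqZeroExt.inl (coord n k) + TrivSqZeroExt.inr (if k = i then (1 : RegFun n) else 0)

theorem fst_dualHom (n : ℕ) (i : Fin n) (p : MvPolynomial (Fin n) ℂ) :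
    (dualHom n i p).fst = algebraMap _ (RegFun n) p := by
  have h : (TrivSqZeroExt.fstHom ℂ (RegFun n) (RegFun n)).comp (dualHom n i) =
      IsScalarTower.toAlgHom ℂ (MvPolynomial (Fin n) ℂ) (RegFun n) :=
    MvPolynomial.algHom_ext fun k => by
      by_cases hk : k = i <;> simp [dualHom, coord, hk]
  exact DFunLike.congr_fun h p

/-- The extension `ℂ[𝔥ʳᵉᵍ] → ℂ[𝔥ʳᵉᵍ][ε]`, `f ↦ f + ε ∂f/∂x_i`. -/
def dualHomReg (n : ℕ) (i : Fin n) :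
    RegFun n →ₐ[ℂ] TrivSqZeroExt (RegFun n) (RegFun n) :=
  IsLocalization.Away.liftAlgHom (disc n) (f := dualHom n i)
    (by
      rw [TrivSqZeroExt.isUnit_iff_isUnit_fst, fst_dualHom]
      exact isUnit_disc n)

theorem dualHomReg_coord (n : ℕ) (i k : Fin n) :
    dualHomReg n i (coord n k) =
      TrivSqZeroExt.inl (coord n k) + TrivSqZeroExt.inr (if k = i then (1 : RegFun n) else 0) := by
  rw [coord, dualHomReg, IsLocalization.Away.liftAlgHom_apply, IsLocalization.Away.lift_eq]
  simp [dualHom, coord]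

theorem fst_dualHomReg (n : ℕ) (i : Fin n) (f : RegFun n) : (dualHomReg n i f).fst = f := by
  have h : (TrivSqZeroExt.fstHom ℂ (RegFun n) (RegFun n)).comp (dualHomReg n i) =
      AlgHom.id ℂ (RegFun n) :=
    regFun_algHom_ext fun k => by by_cases hk : k = i <;> simp [dualHomReg_coord, hk]
  exact DFunLike.congr_fun h f

/-- The partial derivative `∂/∂x_i` on `ℂ[𝔥ʳᵉᵍ]`; see `partialDer_coord`. -/
def partialDer (n : ℕ) (i : Fin n) : Derivation ℂ (RegFun n) (RegFun n) :=
  Derivation.mk'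
    ((TrivSqZeroExt.sndHom (RegFun n) (RegFun n)).restrictScalars ℂ ∘ₗ
      (dualHomReg n i).toLinearMap)
    (fun a b => by simp [fst_dualHomReg, mul_comm])

/-- `∂x_k/∂x_i` is `1` if `k = i` and `0` otherwise. -/
theorem partialDer_coord (n : ℕ) (i k : Fin n) :
    partialDer n i (coord n k) = if k = i then 1 else 0 := by
  by_cases hk : k = i <;> simp [partialDer, dualHomReg_coord, hk]

/-- The pairing `⟨y_i, x_j - x_k⟩`, where `y_1, …, y_n` is the basis of `𝔥` dual to
`x_1, …, x_n`. -/
def pairing {n : ℕ} (i j k : Fin n) : ℂ := (if i = j then 1 else 0) - (if i = k then 1 else 0)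

/-- The Dunkl operator
`D_c(y_i) = ∂/∂x_i - (1/2) ∑_{j ≠ k} c ⟨y_i, x_j - x_k⟩ / (x_j - x_k) (1 - s_{jk})`.
The differences inverted here are units by `isUnit_coord_sub`. -/
def dunkl (n : ℕ) (c : ℂ) (i : Fin n) : HReg n :=
  op (DReg.ofDer (partialDer n i)) -
    (1 / 2 : ℂ) • ∑ j : Fin n, ∑ k ∈ Finset.univ.filter (fun k => j ≠ k),
      (c * pairing i j k) •
        (fn (Ring.inverse (coord n j - coord n k)) * (1 - perm (Equiv.swap j k)))

/-- The rational Cherednik algebra `H_c`, as the subalgebra of `𝒟(𝔥ʳᵉᵍ) ∗ W` generated by `W`,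
the linear functions on `𝔥` and the Dunkl operators. -/
def H (n : ℕ) (c : ℂ) : Subalgebra ℂ (HReg n) :=
  Algebra.adjoin ℂ
    (Set.range (perm : Equiv.Perm (Fin n) → HReg n) ∪
      Set.range (fun i : Fin n => fn (coord n i)) ∪ Set.range (dunkl n c))

/-- The trivial idempotent `e = (1/|W|) ∑_w w`. -/
def e (n : ℕ) : HReg n :=
  (1 / (Fintype.card (Equiv.Perm (Fin n)) : ℂ)) • ∑ w : Equiv.Perm (Fin n), perm w

/-- The subspace `a S b = {a s b : s ∈ S}` of `𝒟(𝔥ʳᵉᵍ) ∗ W`. -/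
def sandwich {n : ℕ} (a : HReg n) (S : Submodule ℂ (HReg n)) (b : HReg n) :
    Submodule ℂ (HReg n) :=
  S.map (LinearMap.mulLeft ℂ a ∘ₗ LinearMap.mulRight ℂ b)

/-- The spherical subalgebra `U_c = e H_c e`, as a subspace of `𝒟(𝔥ʳᵉᵍ) ∗ W`. -/
def U (n : ℕ) (c : ℂ) : Submodule ℂ (HReg n) :=
  sandwich (e n) (H n c).toSubmodule (e n)

/-- The localised spherical algebra `Uʳᵉᵍ = e (𝒟(𝔥ʳᵉᵍ) ∗ W) e`. -/
def UReg (n : ℕ) : Submodule ℂ (HReg n) := sandwich (e n) ⊤ (e n)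

/-- The bimodule `P_{a-1}^a = e H_a δ e`. -/
def POne (n : ℕ) (a : ℂ) : Submodule ℂ (HReg n) :=
  sandwich (e n) (H n a).toSubmodule (discPow n 1 * e n)

/-- The bimodule `Q_a^{a-1} = e δ⁻¹ H_a e`. -/
def QOne (n : ℕ) (a : ℂ) : Submodule ℂ (HReg n) :=
  sandwich (e n * discPow n (-1)) (H n a).toSubmodule (e n)

/-- `P n b j` is the `(U_{b+j}, U_b)`-bimodule `P_b^{b+j}`, for `j ≥ 1`: it is `P_b^{b+1}` for
`j = 1`, and then `P_b^a = P_{a-1}^a · P_b^{a-1}`. Products of subspaces are spans of products.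
(For `j = 0` the value `U_b` is a convention.) -/
def P (n : ℕ) (b : ℂ) : ℕ → Submodule ℂ (HReg n)
  | 0 => U n b
  | 1 => POne n (b + 1)
  | j + 2 => POne n (b + (j + 2)) * P n b (j + 1)

/-- `Q n b j` is the `(U_b, U_{b+j})`-bimodule `Q_{b+j}^b`, for `j ≥ 1`: it is `Q_{b+1}^b` for
`j = 1`, and then `Q_a^b = Q_{b+1}^b · Q_a^{b+1}`. Products of subspaces are spans of products.
(For `j = 0` the value `U_b` is a convention.) -/
def Q (n : ℕ) (b : ℂ) : ℕ → Submodule ℂ (HReg n)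
  | 0 => U n b
  | 1 => QOne n (b + 1)
  | j + 2 => QOne n (b + 1) * Q n (b + 1) (j + 1)

/-- `φ` is the sign twist `φ_c`: the algebra endomorphism of `Hʳᵉᵍ` with `φ(x) = x` for `x ∈ ℂ[𝔥]`,
`φ(D_c(y)) = D_{-c}(y)` for `y ∈ 𝔥`, and `φ(w) = sign(w) w` for `w ∈ W`. -/
structure IsSignTwist {n : ℕ} (c : ℂ) (φ : HReg n →ₐ[ℂ] HReg n) : Prop where
  map_poly : ∀ p : MvPolynomial (Fin n) ℂ,
    φ (fn (algebraMap (MvPolynomial (Fin n) ℂ) (RegFun n) p)) =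
      fn (algebraMap (MvPolynomial (Fin n) ℂ) (RegFun n) p)
  map_dunkl : ∀ i : Fin n, φ (dunkl n c i) = dunkl n (-c) i
  map_perm : ∀ w : Equiv.Perm (Fin n), φ (perm w) = ((Equiv.Perm.sign w : ℤ) : ℂ) • perm w

end Cherednik

end

noncomputable section

namespace Cherednik

/-! The automorphism `φ_c` is the composite of conjugation by the multivalued function `δ^{2c}`,
that is `D ↦ δ^{-2c} D δ^{2c}`, with the sign twist `w ↦ sign(w) w`. With `ℓ_i = ∑_{k≠i} 1/(x_i -
x_k)` the logarithmic derivative of `δ`, it fixes functions and sends `∂_i` to `∂_i + 2c ℓ_i`.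
Changing the sign of the reflections in the Dunkl operator absorbs exactly this extra term
(`signTwistHom_dunkl`). For complex `c` the conjugation is defined by interpolation: `δ^{-m} D δ^m`
is a polynomial in `m ∈ ℕ`, which is then evaluated at `2c`. Uniqueness holds because functions, `W`
and the `∂_i` generate, and each `∂_i` is recovered from a Dunkl operator.

Identity 1 holds on the whole of `𝒟(𝔥ʳᵉᵍ) ∗ W`: raising `c` by one adds one more conjugation by
`δ²`, and `δ²` is `W`-invariant (`signTwistHom_add_one`).

Identity 2 rests on a generation theorem (`Relations.spherical_mem`): `U_c` is generated by the
compressions by `e` of the power sums of the `x_i` and of `∑ y_i²`. On the image of `e` the latter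
is the Calogero–Moser operator `L_c = ∑ ∂_i² - 2c ∑ ℓ_i ∂_i`. Since `δ` is harmonic, `φ_{c+1}(L_c) =
δ⁻¹ L_{-c-1} δ` (`signTwistHom_calogeroMoser`). Also `φ_{c+1}(e) = δ⁻¹ e δ`, both sides being the
sign idempotent, so the two sides of identity 2 have the same generators.

The generation theorem is proved from the commutation relations alone. Commutators with `∑ y_i²`
turn power sums of the `x_i` into all polarised power sums, modulo lower degree in the `y_i`. As in
Weyl's theorem on polarisations, these give all symmetrised monomials. Polynomials in the `y_i` make
sense because Dunkl operators commute (`dunkl_commute`).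

Identity 3 is a direct computation for `j = 1` (`map_POne`). In general the factors of `P` are moved
by identity 1 to the parameter where `map_POne` applies, and the intermediate powers of `δ` cancel
(`map_P`). -/

/-! ### Functions on the regular locus: `1/(x_i - x_k)`, and harmonicity of the discriminant. -/

theorem disc_ne_zero (n : ℕ) : disc n ≠ 0 := by
  refine Finset.prod_ne_zero_iff.2 fun i _ => Finset.prod_ne_zero_iff.2 fun j hj => ?_
  rw [sub_ne_zero]
  exact fun h => (Finset.mem_Ioi.1 hj).ne (MvPolynomial.X_injective h)

instance (n : ℕ) : IsDomain (RegFun n) :=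
  IsLocalization.isDomain_of_le_nonZeroDivisors (RegFun n)
    (powers_le_nonZeroDivisors_of_noZeroDivisors (disc_ne_zero n))

/-- The function `1 / (x_i - x_k)`, with the value `0` for `i = k`. -/
def invDiff {n : ℕ} (i k : Fin n) : RegFun n := Ring.inverse (coord n i - coord n k)

@[simp]
theorem invDiff_self {n : ℕ} (i : Fin n) : invDiff i i = 0 := by simp [invDiff]

theorem mul_invDiff {n : ℕ} {i k : Fin n} (h : i ≠ k) :
    (coord n i - coord n k) * invDiff i k = 1 :=
  Ring.mul_inverse_cancel _ (isUnit_coord_sub n h)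

theorem coord_sub_ne_zero {n : ℕ} {i k : Fin n} (h : i ≠ k) : coord n i - coord n k ≠ 0 :=
  (isUnit_coord_sub n h).ne_zero

theorem invDiff_swap {n : ℕ} (i k : Fin n) : invDiff k i = -invDiff i k := by
  rcases eq_or_ne i k with rfl | h
  · simp
  · refine mul_left_cancel₀ (coord_sub_ne_zero h) ?_
    have h1 := mul_invDiff h
    have h2 := mul_invDiff h.symm
    linear_combination h1 - h2

theorem permHom_invDiff {n : ℕ} (w : Equiv.Perm (Fin n)) (i k : Fin n) :
    permHom n w (invDiff i k) = invDiff (w i) (w k) := by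
  rcases eq_or_ne i k with rfl | h
  · simp
  · have h' : w i ≠ w k := w.injective.ne h
    refine mul_left_cancel₀ (coord_sub_ne_zero h') ?_
    rw [mul_invDiff h', ← permHom_coord, ← permHom_coord, ← map_sub, ← map_mul, mul_invDiff h,
      map_one]

/-- Three functions `1 / (x_i - x_j)` satisfy the classical Yang-Baxter relation. -/
theorem invDiff_cyclic {n : ℕ} {i k l : Fin n} (hik : i ≠ k) (hil : i ≠ l) (hkl : k ≠ l) :
    invDiff i k * invDiff i l + invDiff k l * invDiff k i + invDiff l i * invDiff l k = 0 := by
  refine mul_left_cancel₀ (coord_sub_ne_zero hkl) (mul_left_cancel₀ (coord_sub_ne_zero hil)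
    (mul_left_cancel₀ (coord_sub_ne_zero hik) ?_))
  have h1 := mul_invDiff hik
  have h2 := mul_invDiff hil
  have h3 := mul_invDiff hkl
  rw [invDiff_swap i k, invDiff_swap i l, invDiff_swap k l]
  set a := coord n i
  set b := coord n k
  set d := coord n l
  set p := invDiff i k
  set q := invDiff i l
  set r := invDiff k l
  have e1 : (a - b) * ((a - d) * ((b - d) * (p * q + r * -p + -q * -r))) =
      ((a - b) * p) * ((a - d) * q) * (b - d) - ((a - b) * p) * ((b - d) * r) * (a - d)
        + ((a - d) * q) * ((b - d) * r) * (a - b) := by ring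
  rw [e1, h1, h2, h3]
  ring

/-- The logarithmic derivative `∑_{k ≠ i} 1 / (x_i - x_k)` of the discriminant. -/
def logDer {n : ℕ} (i : Fin n) : RegFun n := ∑ k, invDiff i k

theorem permHom_logDer {n : ℕ} (w : Equiv.Perm (Fin n)) (i : Fin n) :
    permHom n w (logDer i) = logDer (w i) := by
  simp only [logDer, map_sum, permHom_invDiff]
  exact Equiv.sum_comp w fun k => invDiff (w i) k

theorem derivation_prod_of_isUnit {R ι : Type*} [CommRing R] [Algebra ℂ R]
    (d : Derivation ℂ R R) (s : Finset ι) (f : ι → R) (hf : ∀ i ∈ s, IsUnit (f i)) :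
    d (∏ i ∈ s, f i) = (∑ i ∈ s, d (f i) * Ring.inverse (f i)) * ∏ i ∈ s, f i := by
  classical
  induction s using Finset.induction_on with
  | empty => simp
  | insert a s ha ih =>
    rw [Finset.prod_insert ha, Finset.sum_insert ha, Derivation.leibniz,
      ih fun i hi => hf i (Finset.mem_insert_of_mem hi), smul_eq_mul, smul_eq_mul]
    have h := Ring.inverse_mul_cancel _ (hf a (Finset.mem_insert_self a s))
    linear_combination (-(∏ i ∈ s, f i) * d (f a)) * h

theorem coe_discUnit (n : ℕ) :
    (discUnit n : RegFun n) = ∏ i : Fin n, ∏ j ∈ Finset.Ioi i, (coord n i - coord n j) := by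
  simp [discUnit, disc, map_prod, coord]

/-- Among the factors `x_i - x_j` with `i < j`, those with `i = l` contribute `1/(x_l - x_j)` and
those with `j = l` contribute `-1/(x_i - x_l)`; antisymmetry merges the two ranges into one sum. -/
theorem partialDer_discUnit {n : ℕ} (l : Fin n) :
    partialDer n l (discUnit n) = logDer l * discUnit n := by
  rw [coe_discUnit, Finset.prod_sigma', derivation_prod_of_isUnit]
  · congr 1
    rw [Finset.sum_sigma, logDer]
    simp only [map_sub, partialDer_coord]
    change ∑ i : Fin n, ∑ j ∈ Finset.Ioi i,
      ((if i = l then (1 : RegFun n) else 0) - (if j = l then 1 else 0)) * invDiff i j = _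
    simp only [sub_mul, ite_mul, one_mul, zero_mul, Finset.sum_sub_distrib]
    have h1 : ∑ i : Fin n, ∑ j ∈ Finset.Ioi i, (if i = l then invDiff i j else 0) =
        ∑ j ∈ Finset.Ioi l, invDiff l j := by
      rw [Finset.sum_eq_single l]
      · simp
      · intro b _ hb
        simp [hb]
      · simp
    have h2 : ∑ i : Fin n, ∑ j ∈ Finset.Ioi i, (if j = l then invDiff i j else 0) =
        ∑ i ∈ Finset.Iio l, invDiff i l := by
      simp only [Finset.sum_ite_eq', Finset.mem_Ioi]
      rw [← Finset.sum_filter]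
      congr 1
      ext; simp
    rw [h1, h2, sub_eq_add_neg, ← Finset.sum_neg_distrib]
    simp only [← invDiff_swap]
    have h3 : (Finset.univ : Finset (Fin n)) = insert l (Finset.Ioi l ∪ Finset.Iio l) := by
      ext j
      simp
      grind
    rw [h3, Finset.sum_insert (by simp), Finset.sum_union]
    · simp
    · exact Finset.disjoint_left.2 fun j => by simpa using fun h => le_of_lt h
  · rintro ⟨i, j⟩ h
    simp only [Finset.mem_sigma, Finset.mem_univ, Finset.mem_Ioi, true_and] at h
    exact isUnit_coord_sub n h.ne

theorem partialDer_invDiff_same {n : ℕ} (i k : Fin n) :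
    partialDer n i (invDiff i k) = -(invDiff i k * invDiff i k) := by
  rcases eq_or_ne i k with rfl | h
  · simp
  · have h1 := mul_invDiff h
    have h2 := congrArg (partialDer n i) h1
    rw [Derivation.leibniz, map_sub, partialDer_coord, partialDer_coord, if_pos rfl,
      if_neg h.symm, Derivation.map_one_eq_zero, smul_eq_mul, smul_eq_mul] at h2
    linear_combination invDiff i k * h2 - (partialDer n i (invDiff i k)) * h1

/-- The discriminant is harmonic. -/
theorem sum_partialDer_logDer (n : ℕ) :
    ∑ i : Fin n, (partialDer n i (logDer i) + logDer i * logDer i) = 0 := by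
  -- The diagonal terms `k = l` of `ℓ_i²` cancel against `∂_i ℓ_i`; `a` collects the terms that
  -- remain.
  set a : Fin n → Fin n → Fin n → RegFun n :=
    fun i k l => if k = l then 0 else invDiff i k * invDiff i l with ha
  have h1 : ∀ i : Fin n, partialDer n i (logDer i) + logDer i * logDer i =
      ∑ k, ∑ l, a i k l := by
    intro i
    simp only [logDer, map_sum, partialDer_invDiff_same, Finset.sum_mul_sum]
    rw [← Finset.sum_add_distrib]
    refine Finset.sum_congr rfl fun k _ => ?_
    have : ∀ l, a i k l = invDiff i k * invDiff i l -
        if k = l then invDiff i k * invDiff i l else 0 := by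
      intro l
      by_cases h : k = l <;> simp [ha, h]
    simp only [this, Finset.sum_sub_distrib, Finset.sum_ite_eq, Finset.mem_univ, if_true]
    ring
  simp only [h1]
  -- Summing over cyclic rotations reduces the claim to the three-term relation; triples with a
  -- repeated index vanish because `invDiff i i = 0`.
  have h2 : ∀ i k l, a i k l + a k l i + a l i k = 0 := by
    intro i k l
    by_cases hik : i = k <;> by_cases hil : i = l <;> by_cases hkl : k = l
    all_goals first
      | (subst_vars; simp [ha]; done)
      | skip
    simp only [ha, if_neg hkl, if_neg (Ne.symm hil), if_neg hik]
    exact invDiff_cyclic hik hil hkl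
  have h3 : ∑ i, ∑ k, ∑ l, a i k l = ∑ i, ∑ k, ∑ l, a k l i := by
    rw [Finset.sum_comm_cycle]
  have h4 : ∑ i, ∑ k, ∑ l, a i k l = ∑ i, ∑ k, ∑ l, a l i k := by
    rw [Finset.sum_comm_cycle, Finset.sum_comm_cycle]
  have h5 : (3 : RegFun n) * ∑ i, ∑ k, ∑ l, a i k l = 0 := by
    have : (3 : RegFun n) * ∑ i, ∑ k, ∑ l, a i k l =
        ∑ i, ∑ k, ∑ l, (a i k l + a k l i + a l i k) := by
      simp only [Finset.sum_add_distrib]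
      rw [← h3, ← h4]; ring
    rw [this]
    simp [h2]
  have h6 : (3 : RegFun n) ≠ 0 := by
    have := (algebraMap ℂ (RegFun n)).injective.ne (show (3 : ℂ) ≠ 0 by norm_num)
    rwa [map_ofNat, map_zero] at this
  exact (mul_eq_zero.1 h5).resolve_left h6

theorem derivation_regFun_ext {n : ℕ} {d d' : Derivation ℂ (RegFun n) (RegFun n)}
    (h : ∀ i, d (coord n i) = d' (coord n i)) : d = d' := by
  have hp : ∀ p : MvPolynomial (Fin n) ℂ, d (algebraMap _ (RegFun n) p) =
      d' (algebraMap _ (RegFun n) p) := by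
    have : d.compAlgebraMap (MvPolynomial (Fin n) ℂ) = d'.compAlgebraMap _ :=
      MvPolynomial.derivation_ext h
    exact fun p => DFunLike.congr_fun this p
  refine Derivation.ext fun f => ?_
  obtain ⟨⟨p, s⟩, hps⟩ := IsLocalization.surj (Submonoid.powers (disc n)) f
  have hs : IsUnit (algebraMap _ (RegFun n) (s : MvPolynomial (Fin n) ℂ)) :=
    IsLocalization.map_units (RegFun n) s
  have h1 := congrArg d hps
  have h2 := congrArg d' hps
  simp only [Derivation.leibniz, smul_eq_mul, hp] at h1 h2
  refine hs.mul_left_cancel ?_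
  linear_combination h1 - h2

theorem derivation_eq_sum {n : ℕ} (d : Derivation ℂ (RegFun n) (RegFun n)) :
    d = ∑ i, d (coord n i) • partialDer n i := by
  refine derivation_regFun_ext fun k => ?_
  rw [← Derivation.coeFnAddMonoidHom_apply, ← Derivation.coeFnAddMonoidHom_apply, map_sum]
  simp [Finset.sum_apply, partialDer_coord]

/-- The conjugate of `∂_i` by `w` is again a derivation, so it is determined by its values on
coordinates. -/
theorem permHom_partialDer {n : ℕ} (w : Equiv.Perm (Fin n)) (i : Fin n) (f : RegFun n) :
    permHom n w (partialDer n i f) = partialDer n (w i) (permHom n w f) := by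
  let d : Derivation ℂ (RegFun n) (RegFun n) := Derivation.mk'
    ((permHom n w).toLinearMap ∘ₗ (partialDer n i).toLinearMap ∘ₗ (permHom n w⁻¹).toLinearMap)
    (fun a b => by simp [permHom_inv_apply])
  have hd : d = partialDer n (w i) := derivation_regFun_ext fun k => by
    change permHom n w (partialDer n i (permHom n w⁻¹ (coord n k))) = _
    simp only [permHom_coord, partialDer_coord, Equiv.Perm.inv_eq_iff_eq, apply_ite (permHom n w),
      map_one, map_zero]
  rw [← hd]
  change _ = permHom n w (partialDer n i (permHom n w⁻¹ (permHom n w f)))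
  rw [permHom_inv_apply']

end Cherednik

/-! ### Differential operators and their conjugation by complex powers of the discriminant. -/

namespace Cherednik

namespace DReg

variable {n : ℕ}

/-- A differential operator as a linear endomorphism of the ring of functions. -/
def act (D : DReg n) : Module.End ℂ (RegFun n) := D.1

theorem ext' {D D' : DReg n} (h : ∀ f : RegFun n, D.act f = D'.act f) : D = D' :=
  Subtype.ext (LinearMap.ext h)

@[simp] theorem val_mul (D D' : DReg n) (f : RegFun n) : (D * D').act f = D.act (D'.act f) := rfl

@[simp] theorem val_add (D D' : DReg n) (f : RegFun n) : (D + D').act f = D.act f + D'.act f := rfl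

@[simp] theorem val_sub (D D' : DReg n) (f : RegFun n) : (D - D').act f = D.act f - D'.act f := rfl

@[simp] theorem val_zero (f : RegFun n) : (0 : DReg n).act f = 0 := rfl

@[simp] theorem val_one (f : RegFun n) : (1 : DReg n).act f = f := rfl

@[simp] theorem val_smul (c : ℂ) (D : DReg n) (f : RegFun n) : (c • D).act f = c • D.act f := rfl

@[simp] theorem val_ofFun (g f : RegFun n) : (ofFun g).act f = g * f := rfl

@[simp] theorem val_ofDer (d : Derivation ℂ (RegFun n) (RegFun n)) (f : RegFun n) :
    (ofDer d).act f = d f := rfl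

theorem val_perm_smul (w : Equiv.Perm (Fin n)) (D : DReg n) (f : RegFun n) :
    (w • D).act f = permHom n w (D.act (permHom n w⁻¹ f)) := rfl

@[simp] theorem val_sum {ι : Type*} (s : Finset ι) (D : ι → DReg n) (f : RegFun n) :
    (∑ i ∈ s, D i).act f = ∑ i ∈ s, (D i).act f := by
  classical
  induction s using Finset.induction_on with
  | empty => simp
  | insert a s ha ih => rw [Finset.sum_insert ha, Finset.sum_insert ha, val_add, ih]

/-- Functions as differential operators. -/
def funHom (n : ℕ) : RegFun n →ₐ[ℂ] DReg n where
  toFun := ofFun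
  map_one' := ext' fun f => by simp
  map_mul' a b := ext' fun f => by simp [mul_assoc]
  map_zero' := ext' fun f => by simp
  map_add' a b := ext' fun f => by simp [add_mul]
  commutes' c := ext' fun f => by
    rw [Algebra.algebraMap_eq_smul_one, Algebra.algebraMap_eq_smul_one]
    simp

theorem funHom_apply (f : RegFun n) : funHom n f = ofFun f := rfl

theorem ofFun_mul (f g : RegFun n) : (ofFun (f * g) : DReg n) = ofFun f * ofFun g :=
  map_mul (funHom n) f g

theorem ofFun_one : (ofFun 1 : DReg n) = 1 := map_one (funHom n)

theorem ofFun_add (f g : RegFun n) : (ofFun (f + g) : DReg n) = ofFun f + ofFun g :=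
  map_add (funHom n) f g

theorem ofDer_mul_ofFun (d : Derivation ℂ (RegFun n) (RegFun n)) (f : RegFun n) :
    (ofDer d * ofFun f : DReg n) = ofFun f * ofDer d + ofFun (d f) :=
  ext' fun g => by simp [mul_comm g]

theorem ofDer_eq_sum (d : Derivation ℂ (RegFun n) (RegFun n)) :
    (ofDer d : DReg n) = ∑ i, ofFun (d (coord n i)) * ofDer (partialDer n i) := by
  refine ext' fun f => ?_
  rw [val_ofDer]
  conv_lhs => rw [derivation_eq_sum d]
  rw [← Derivation.coeFnAddMonoidHom_apply, map_sum]
  simp [Finset.sum_apply]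

theorem smul_ofFun (w : Equiv.Perm (Fin n)) (f : RegFun n) :
    w • (ofFun f : DReg n) = ofFun (permHom n w f) :=
  ext' fun g => by simp [val_perm_smul, permHom_inv_apply]

theorem smul_ofDer (w : Equiv.Perm (Fin n)) (i : Fin n) :
    w • (ofDer (partialDer n i) : DReg n) = ofDer (partialDer n (w i)) :=
  ext' fun g => by simp [val_perm_smul, permHom_inv_apply, permHom_partialDer]

/-- Induction along the generators of the ring of differential operators. -/
theorem induction {p : DReg n → Prop} (hf : ∀ f, p (ofFun f)) (hd : ∀ i, p (ofDer (partialDer n i)))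
    (ha : ∀ D D', p D → p D' → p (D + D')) (hm : ∀ D D', p D → p D' → p (D * D')) (D : DReg n) :
    p D := by
  obtain ⟨D, hD⟩ := D
  have h0 : p 0 := by
    have := hf 0
    rwa [← funHom_apply, map_zero] at this
  refine Algebra.adjoin_induction (p := fun D hD => p ⟨D, hD⟩) ?_ ?_ ?_ ?_ hD
  · rintro _ (⟨f, rfl⟩ | ⟨d, rfl⟩)
    · exact hf f
    · have : p (ofDer d) := by
        rw [ofDer_eq_sum]
        exact Finset.sum_induction _ p ha h0 fun i _ => hm _ _ (hf _) (hd i)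
      exact this
  · intro c
    have := hf (algebraMap ℂ _ c)
    rwa [← funHom_apply, AlgHom.commutes] at this
  · exact fun x y hx hy h1 h2 => ha ⟨x, hx⟩ ⟨y, hy⟩ h1 h2
  · exact fun x y hx hy h1 h2 => hm ⟨x, hx⟩ ⟨y, hy⟩ h1 h2

theorem algHom_ext {B : Type*} [Ring B] [Algebra ℂ B] {f g : DReg n →ₐ[ℂ] B}
    (hf : ∀ a, f (ofFun a) = g (ofFun a))
    (hd : ∀ i, f (ofDer (partialDer n i)) = g (ofDer (partialDer n i))) : f = g := by
  refine AlgHom.ext fun D => ?_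
  refine induction (p := fun D => f D = g D) hf hd ?_ ?_ D
  · intro D D' h h'
    rw [map_add, map_add, h, h']
  · intro D D' h h'
    rw [map_mul, map_mul, h, h']

/-- Evaluation of polynomials with coefficients in differential operators at a scalar. -/
def evalAt (c : ℂ) : Polynomial (DReg n) →ₐ[ℂ] DReg n where
  __ := Polynomial.eval₂RingHom' (RingHom.id (DReg n)) (algebraMap ℂ (DReg n) c)
    fun a => (Algebra.commutes c a).symm
  commutes' a := by
    change Polynomial.eval₂ _ _ (algebraMap ℂ (Polynomial (DReg n)) a) = _
    rw [Polynomial.algebraMap_apply, Polynomial.eval₂_C]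
    rfl

theorem evalAt_apply (c : ℂ) (p : Polynomial (DReg n)) :
    evalAt c p = p.eval (algebraMap ℂ (DReg n) c) := rfl

@[simp] theorem evalAt_C (c : ℂ) (D : DReg n) : evalAt c (Polynomial.C D) = D := by
  simp [evalAt_apply]

@[simp] theorem evalAt_X (c : ℂ) : evalAt c (Polynomial.X : Polynomial (DReg n)) =
    algebraMap ℂ (DReg n) c := by
  simp [evalAt_apply]

/-- Applying the coefficients to a fixed function `f` gives a polynomial over the domain `RegFun n`
of characteristic zero; it vanishes at every natural number, so it is zero. -/
theorem eq_of_evalAt_natCast {p q : Polynomial (DReg n)}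
    (h : ∀ m : ℕ, evalAt (m : ℂ) p = evalAt (m : ℂ) q) : p = q := by
  rw [← sub_eq_zero]
  have h' : ∀ m : ℕ, evalAt (m : ℂ) (p - q) = 0 := fun m => by rw [map_sub, h, sub_self]
  set r := p - q
  refine Polynomial.ext fun k => ext' fun f => ?_
  let P : Polynomial (RegFun n) := r.sum fun k D => Polynomial.monomial k (D.act f)
  have hP : ∀ m : ℕ, P.eval (m : RegFun n) = 0 := by
    intro m
    have h1 := congrArg (fun D : DReg n => D.act f) (h' m)
    simp only [val_zero] at h1
    rw [← h1, evalAt_apply, Polynomial.eval_eq_sum (p := r), Polynomial.sum, val_sum]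
    simp only [P, Polynomial.sum, Polynomial.eval_finsetSum]
    refine Finset.sum_congr rfl fun i _ => ?_
    rw [Polynomial.eval_monomial, ← map_pow, mul_comm, ← Algebra.commutes,
      ← Algebra.smul_def, val_smul, Algebra.smul_def]
    simp
  have : CharZero (RegFun n) := charZero_of_injective_algebraMap (algebraMap ℂ (RegFun n)).injective
  have hP0 : P = 0 := Polynomial.eq_zero_of_infinite_isRoot P
    ((Set.infinite_range_of_injective (Nat.cast_injective (R := RegFun n))).mono (by
      rintro _ ⟨m, rfl⟩
      exact hP m))
  have h2 := congrArg (fun P => Polynomial.coeff P k) hP0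
  simp only [P, Polynomial.sum, Polynomial.finsetSum_coeff, Polynomial.coeff_monomial,
    Finset.sum_ite_eq', Polynomial.coeff_zero] at h2
  by_cases hk : k ∈ r.support
  · simpa [hk] using h2
  · rw [Polynomial.notMem_support_iff.1 hk]
    rfl

/-- Conjugation by a power of the discriminant. -/
def conjPow (m : ℕ) (D : DReg n) : DReg n :=
  ofFun ((discUnit n)⁻¹ ^ m : (RegFun n)ˣ) * D * ofFun ((discUnit n) ^ m : (RegFun n)ˣ)

theorem conjPow_mul (m : ℕ) (D D' : DReg n) :
    conjPow m (D * D') = conjPow m D * conjPow m D' := by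
  have h : (ofFun ((discUnit n) ^ m : (RegFun n)ˣ) : DReg n) *
      ofFun ((discUnit n)⁻¹ ^ m : (RegFun n)ˣ) = 1 := by
    rw [← ofFun_mul, ← Units.val_mul, ← mul_pow, mul_inv_cancel, one_pow, Units.val_one, ofFun_one]
  simp only [conjPow]
  generalize (ofFun ((discUnit n) ^ m : (RegFun n)ˣ) : DReg n) = a at *
  generalize (ofFun ((discUnit n)⁻¹ ^ m : (RegFun n)ˣ) : DReg n) = b at *
  calc b * (D * D') * a = b * D * 1 * D' * a := by simp only [mul_one, mul_assoc]
    _ = _ := by rw [← h]; simp only [mul_assoc]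

theorem conjPow_ofFun (m : ℕ) (f : RegFun n) : conjPow m (ofFun f) = ofFun f := by
  rw [conjPow, ← ofFun_mul, ← ofFun_mul, mul_right_comm, ← Units.val_mul, ← mul_pow,
    inv_mul_cancel, one_pow, Units.val_one, one_mul]

theorem conjPow_ofDer (m : ℕ) (i : Fin n) : conjPow m (ofDer (partialDer n i)) =
    ofDer (partialDer n i) + (m : ℂ) • ofFun (logDer i) := by
  have h1 : partialDer n i ((discUnit n : RegFun n) ^ m) =
      m * logDer i * (discUnit n : RegFun n) ^ m := by
    rw [Derivation.leibniz_pow, partialDer_discUnit]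
    cases m with
    | zero => simp
    | succ m =>
      simp only [smul_eq_mul, nsmul_eq_mul, add_tsub_cancel_right]
      ring
  have h2 : ((((discUnit n)⁻¹ ^ m : (RegFun n)ˣ)) : RegFun n) * (discUnit n : RegFun n) ^ m = 1 := by
    rw [← Units.val_pow_eq_pow_val, ← Units.val_mul, ← mul_pow, inv_mul_cancel, one_pow,
      Units.val_one]
  refine ext' fun f => ?_
  simp only [conjPow, val_mul, val_ofFun, val_ofDer, Units.val_pow_eq_pow_val (discUnit n),
    Derivation.leibniz, h1, smul_eq_mul, val_add, val_smul]
  rw [Algebra.smul_def, map_natCast]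
  linear_combination (partialDer n i f + f * m * logDer i) * h2

/-- The conjugate by `δ^m` is constant in `m` on functions and linear in `m` on the `∂_i`;
polynomial dependence survives sums and products. -/
theorem exists_poly (D : DReg n) :
    ∃ p : Polynomial (DReg n), ∀ m : ℕ, evalAt (m : ℂ) p = conjPow m D := by
  refine induction (p := fun D => ∃ p : Polynomial (DReg n), ∀ m : ℕ,
    evalAt (m : ℂ) p = conjPow m D) ?_ ?_ ?_ ?_ D
  · exact fun f => ⟨Polynomial.C (ofFun f), fun m => by rw [evalAt_C, conjPow_ofFun]⟩
  · refine fun i => ⟨Polynomial.C (ofDer (partialDer n i)) +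
      Polynomial.X * Polynomial.C (ofFun (logDer i)), fun m => ?_⟩
    rw [map_add, map_mul, evalAt_C, evalAt_C, evalAt_X, conjPow_ofDer, Algebra.smul_def]
  · rintro D D' ⟨p, hp⟩ ⟨q, hq⟩
    refine ⟨p + q, fun m => ?_⟩
    rw [map_add, hp, hq, conjPow, conjPow, conjPow, mul_add, add_mul]
  · rintro D D' ⟨p, hp⟩ ⟨q, hq⟩
    exact ⟨p * q, fun m => by rw [map_mul, hp, hq, conjPow_mul]⟩

/-- The polynomial in `m` interpolating the conjugates `δ⁻ᵐ D δᵐ`. -/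
def conjPoly (n : ℕ) : DReg n →ₐ[ℂ] Polynomial (DReg n) :=
  -- The interpolating polynomial is unique, so linearity and multiplicativity need only be checked
  -- at natural numbers, where they hold for honest conjugation.
  AlgHom.ofLinearMap
    { toFun := fun D => (exists_poly D).choose
      map_add' := fun D D' => eq_of_evalAt_natCast fun m => by
        rw [map_add, (exists_poly _).choose_spec, (exists_poly _).choose_spec,
          (exists_poly _).choose_spec, conjPow, conjPow, conjPow, mul_add, add_mul]
      map_smul' := fun c D => eq_of_evalAt_natCast fun m => by
        rw [map_smul, (exists_poly _).choose_spec, (exists_poly _).choose_spec, conjPow,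
          conjPow, mul_smul_comm, smul_mul_assoc]
        rfl }
    (eq_of_evalAt_natCast fun m => by
      change evalAt _ (exists_poly _).choose = _
      rw [(exists_poly _).choose_spec, map_one, ← ofFun_one, conjPow_ofFun])
    (fun D D' => eq_of_evalAt_natCast fun m => by
      change evalAt _ (exists_poly _).choose =
        evalAt _ ((exists_poly _).choose * (exists_poly _).choose)
      rw [(exists_poly _).choose_spec, map_mul, (exists_poly _).choose_spec,
          (exists_poly _).choose_spec, conjPow_mul])

theorem evalAt_conjPoly (m : ℕ) (D : DReg n) :
    evalAt (m : ℂ) (conjPoly n D) = conjPow m D := (exists_poly D).choose_spec m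

/-- Conjugation of differential operators by the multivalued function `δᶜ`,
`D ↦ δ⁻ᶜ D δᶜ`. -/
def twist (c : ℂ) : DReg n →ₐ[ℂ] DReg n := (evalAt c).comp (conjPoly n)

@[simp] theorem twist_ofFun (c : ℂ) (f : RegFun n) : twist c (ofFun f) = ofFun f := by
  have : conjPoly n (ofFun f) = Polynomial.C (ofFun f) := eq_of_evalAt_natCast fun m => by
    rw [evalAt_conjPoly, evalAt_C, conjPow_ofFun]
  rw [twist, AlgHom.comp_apply, this, evalAt_C]

@[simp] theorem twist_ofDer (c : ℂ) (i : Fin n) : twist c (ofDer (partialDer n i)) =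
    ofDer (partialDer n i) + c • ofFun (logDer i) := by
  have : conjPoly n (ofDer (partialDer n i)) = Polynomial.C (ofDer (partialDer n i)) +
      Polynomial.X * Polynomial.C (ofFun (logDer i)) := eq_of_evalAt_natCast fun m => by
    rw [evalAt_conjPoly, map_add, map_mul, evalAt_C, evalAt_C, evalAt_X, conjPow_ofDer,
      Algebra.smul_def]
  rw [twist, AlgHom.comp_apply, this, map_add, map_mul, evalAt_C, evalAt_C, evalAt_X,
    Algebra.smul_def]

/-- Holds because `W` permutes the logarithmic derivatives `ℓ_i`. This is what lets the twist extend
to the skew group ring. -/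
theorem twist_perm_smul (c : ℂ) (w : Equiv.Perm (Fin n)) (D : DReg n) :
    twist c (w • D) = w • twist c D := by
  refine induction (p := fun D => twist c (w • D) = w • twist c D) ?_ ?_ ?_ ?_ D
  · intro f
    rw [smul_ofFun, twist_ofFun, twist_ofFun, smul_ofFun]
  · intro i
    rw [smul_ofDer, twist_ofDer, twist_ofDer, smul_add, smul_comm, smul_ofDer, smul_ofFun,
      permHom_logDer]
  · intro D D' h h'
    rw [smul_add, map_add, h, h', map_add, smul_add]
  · intro D D' h h'
    rw [smul_mul', map_mul, h, h', map_mul, smul_mul']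

/-- The commutator with a function is locally nilpotent on differential operators. -/
theorem exists_iterate_commutator (f : RegFun n) (D : DReg n) :
    ∃ m : ℕ, (fun E : DReg n => E * ofFun f - ofFun f * E)^[m] D = 0 := by
  set ad : DReg n →ₗ[ℂ] DReg n :=
    LinearMap.mulRight ℂ (ofFun f) - LinearMap.mulLeft ℂ (ofFun f) with had
  have hA : ∀ E, ad E = E * ofFun f - ofFun f * E := fun E => rfl
  suffices h : ∃ m : ℕ, (ad ^ m) D = 0 by
    obtain ⟨m, hm⟩ := h
    refine ⟨m, ?_⟩
    rwa [Module.End.pow_apply] at hm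
  have hmono : ∀ (E : DReg n) {m k : ℕ}, m ≤ k → (ad ^ m) E = 0 → (ad ^ k) E = 0 := by
    intro E m k hmk h
    obtain ⟨j, rfl⟩ := Nat.exists_eq_add_of_le' hmk
    rw [pow_add, Module.End.mul_apply, h, map_zero]
  refine induction (p := fun D => ∃ m : ℕ, (ad ^ m) D = 0) ?_ ?_ ?_ ?_ D
  · intro g
    refine ⟨1, ?_⟩
    rw [pow_one, hA, ← ofFun_mul, ← ofFun_mul, mul_comm, sub_self]
  · intro i
    refine ⟨2, ?_⟩
    rw [pow_two, Module.End.mul_apply, hA (ofDer _), ofDer_mul_ofFun, add_sub_cancel_left, hA,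
      ← ofFun_mul, ← ofFun_mul, mul_comm, sub_self]
  · rintro D D' ⟨a, h⟩ ⟨b, h'⟩
    refine ⟨max a b, ?_⟩
    rw [map_add, hmono D (le_max_left a b) h, hmono D' (le_max_right a b) h', add_zero]
  -- `ad` is a derivation, so nilpotency orders add under products; each application lowers one of
  -- the two orders.
  · have key : ∀ N : ℕ, ∀ a b : ℕ, a + b = N → ∀ D D' : DReg n, (ad ^ a) D = 0 →
        (ad ^ b) D' = 0 → (ad ^ N) (D * D') = 0 := by
      intro N
      induction N with
      | zero =>
        intro a b hab D D' h h'
        obtain ⟨rfl, rfl⟩ : a = 0 ∧ b = 0 := by omega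
        simp only [pow_zero, Module.End.one_apply] at h ⊢
        rw [h, zero_mul]
      | succ N ih =>
        intro a b hab D D' h h'
        have hleib : ad (D * D') = ad D * D' + D * ad D' := by
          simp only [hA]; noncomm_ring
        rw [pow_succ, Module.End.mul_apply, hleib, map_add]
        have e1 : (ad ^ N) (ad D * D') = 0 := by
          cases a with
          | zero =>
            simp only [pow_zero, Module.End.one_apply] at h
            rw [h, map_zero, zero_mul, map_zero]
          | succ a =>
            refine ih a b (by omega) _ _ ?_ h'
            rwa [pow_succ, Module.End.mul_apply] at h
        have e2 : (ad ^ N) (D * ad D') = 0 := by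
          cases b with
          | zero =>
            simp only [pow_zero, Module.End.one_apply] at h'
            rw [h', map_zero, mul_zero, map_zero]
          | succ b =>
            refine ih a b (by omega) _ _ h ?_
            rwa [pow_succ, Module.End.mul_apply] at h'
        rw [e1, e2, add_zero]
    rintro D D' ⟨a, h⟩ ⟨b, h'⟩
    exact ⟨a + b, key _ a b rfl D D' h h'⟩

/-- A differential operator that intertwines two different coordinates vanishes. -/
theorem eq_zero_of_intertwines {i k : Fin n} (hik : i ≠ k) {D : DReg n}
    (h : D * ofFun (coord n i) = ofFun (coord n k) * D) : D = 0 := by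
  obtain ⟨m, hm⟩ := exists_iterate_commutator (coord n i) D
  -- On such a `D` the commutator with `x_i` is left multiplication by the nonzero function `x_k -
  -- x_i`, which is nilpotent on `D` only if `D = 0`.
  have key : ∀ m : ℕ, (fun E : DReg n => E * ofFun (coord n i) - ofFun (coord n i) * E)^[m] D =
      ofFun ((coord n k - coord n i) ^ m) * D := by
    intro m
    induction m with
    | zero => rw [Function.iterate_zero, id, pow_zero, ofFun_one, one_mul]
    | succ m ih =>
      rw [Function.iterate_succ_apply', ih, mul_assoc, h, ← mul_assoc, ← mul_assoc, ← ofFun_mul,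
        ← ofFun_mul, ← sub_mul]
      congr 1
      refine ext' fun f => ?_
      simp only [val_sub, val_ofFun]
      ring
  rw [key] at hm
  refine ext' fun f => ?_
  have h1 := congrArg (fun D : DReg n => D.act f) hm
  simp only [val_mul, val_ofFun, val_zero] at h1
  exact (mul_eq_zero.1 h1).resolve_left (pow_ne_zero _ (coord_sub_ne_zero hik.symm))

end DReg

end Cherednik

/-! ### The skew group ring and the sign twist. -/

namespace Cherednik

variable {n : ℕ}

theorem single_eq (w : Equiv.Perm (Fin n)) (D : DReg n) :
    (SkewMonoidAlgebra.single w D : HReg n) = op D * perm w := by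
  simp [op, perm, SkewMonoidAlgebra.single_mul_single]

/-- Differential operators as elements of the skew group ring. -/
def opHom (n : ℕ) : DReg n →ₐ[ℂ] HReg n where
  __ := SkewMonoidAlgebra.singleOneRingHom
  commutes' _ := rfl

theorem opHom_apply (D : DReg n) : opHom n D = op D := rfl

theorem op_mul (D D' : DReg n) : op (D * D') = op D * op D' := map_mul (opHom n) D D'

theorem op_add (D D' : DReg n) : op (D + D') = op D + op D' := map_add (opHom n) D D'

theorem op_smul (c : ℂ) (D : DReg n) : op (c • D) = c • op D := map_smul (opHom n) c D

/-- Functions as elements of the skew group ring. -/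
def fnHom (n : ℕ) : RegFun n →ₐ[ℂ] HReg n := (opHom n).comp (DReg.funHom n)

theorem fnHom_apply (f : RegFun n) : fnHom n f = fn f := rfl

theorem fn_mul (f g : RegFun n) : (fn (f * g) : HReg n) = fn f * fn g := map_mul (fnHom n) f g

theorem fn_one : (fn 1 : HReg n) = 1 := map_one (fnHom n)

theorem fn_zero : (fn 0 : HReg n) = 0 := map_zero (fnHom n)

theorem fn_add (f g : RegFun n) : (fn (f + g) : HReg n) = fn f + fn g := map_add (fnHom n) f g

theorem fn_sub (f g : RegFun n) : (fn (f - g) : HReg n) = fn f - fn g := map_sub (fnHom n) f g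

theorem fn_neg (f : RegFun n) : (fn (-f) : HReg n) = -fn f := map_neg (fnHom n) f

theorem fn_sum {ι : Type*} (s : Finset ι) (f : ι → RegFun n) :
    (fn (∑ i ∈ s, f i) : HReg n) = ∑ i ∈ s, fn (f i) := map_sum (fnHom n) f s

theorem fn_commute (f g : RegFun n) : (fn f * fn g : HReg n) = fn g * fn f := by
  rw [← fn_mul, mul_comm, fn_mul]

/-- The group `W` inside the skew group ring. -/
def permMonoidHom (n : ℕ) : Equiv.Perm (Fin n) →* HReg n where
  toFun := perm
  map_one' := rfl
  map_mul' v w := by simp [perm, SkewMonoidAlgebra.single_mul_single]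

theorem perm_mul (v w : Equiv.Perm (Fin n)) : (perm (v * w) : HReg n) = perm v * perm w :=
  map_mul (permMonoidHom n) v w

theorem perm_one : (perm 1 : HReg n) = 1 := rfl

theorem perm_mul_op (w : Equiv.Perm (Fin n)) (D : DReg n) :
    perm w * op D = op (w • D) * perm w := by
  simp [op, perm, SkewMonoidAlgebra.single_mul_single]

theorem perm_mul_fn (w : Equiv.Perm (Fin n)) (f : RegFun n) :
    (perm w * fn f : HReg n) = fn (permHom n w f) * perm w := by
  rw [fn, perm_mul_op, DReg.smul_ofFun, fn]

/-- The vector field `∂/∂x_i` as an element of the skew group ring. -/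
def del (n : ℕ) (i : Fin n) : HReg n := op (DReg.ofDer (partialDer n i))

theorem perm_mul_del (w : Equiv.Perm (Fin n)) (i : Fin n) :
    perm w * del n i = del n (w i) * perm w := by
  rw [del, perm_mul_op, DReg.smul_ofDer, del]

theorem del_mul_fn (i : Fin n) (f : RegFun n) :
    del n i * fn f = fn f * del n i + fn (partialDer n i f) := by
  rw [del, fn, ← op_mul, DReg.ofDer_mul_ofFun, op_add, op_mul, fn]

theorem hReg_algHom_ext {B : Type*} [Ring B] [Algebra ℂ B] {φ ψ : HReg n →ₐ[ℂ] B}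
    (hf : ∀ f : RegFun n, φ (fn f) = ψ (fn f)) (hd : ∀ i, φ (del n i) = ψ (del n i))
    (hw : ∀ w, φ (perm w) = ψ (perm w)) : φ = ψ := by
  have h : φ.comp (opHom n) = ψ.comp (opHom n) := DReg.algHom_ext hf hd
  refine AlgHom.ext fun z => ?_
  refine SkewMonoidAlgebra.induction_on' (p := fun z => φ z = ψ z) z (fun w D => ?_) fun a b ha hb => ?_
  · rw [single_eq, map_mul, map_mul, hw]
    exact congrArg (· * _) (DFunLike.congr_fun h D)
  · rw [map_add, map_add, ha, hb]

/-- The summand is antisymmetric in `(j, k)`, as is the pairing, so the ordered pairs `(i, k)` and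
`(k, i)` contribute equally and the factor `1/2` disappears. -/
theorem dunkl_eq (c : ℂ) (i : Fin n) : dunkl n c i =
    del n i - c • ∑ k, fn (invDiff i k) * (1 - perm (Equiv.swap i k)) := by
  set T : Fin n → Fin n → HReg n := fun j k => fn (invDiff j k) * (1 - perm (Equiv.swap j k))
    with hT
  have h0 : ∀ j, T j j = 0 := fun j => by simp [hT, fn_zero]
  have h1 : ∀ j k, T k j = -T j k := fun j k => by
    simp only [hT]
    rw [invDiff_swap j k, fn_neg, Equiv.swap_comm, neg_mul]
  rw [dunkl, ← del]
  congr 1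
  have h2 : ∀ j : Fin n, ∑ k ∈ Finset.univ.filter (fun k => j ≠ k), (c * pairing i j k) • T j k =
      ∑ k, (c * pairing i j k) • T j k := by
    intro j
    refine Finset.sum_filter_of_ne fun k _ h => ?_
    rintro rfl
    exact h (by rw [h0, smul_zero])
  change (1 / 2 : ℂ) • ∑ j : Fin n, ∑ k ∈ Finset.univ.filter (fun k => j ≠ k),
    (c * pairing i j k) • T j k = c • ∑ k, T i k
  rw [Finset.sum_congr rfl fun j _ => h2 j]
  simp only [mul_smul, ← Finset.smul_sum]
  rw [smul_comm]
  congr 1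
  simp only [pairing, sub_smul, Finset.sum_sub_distrib, ite_smul, one_smul, zero_smul]
  have h3 : ∑ j : Fin n, ∑ k, (if i = j then T j k else 0) = ∑ k, T i k := by
    rw [Finset.sum_comm]; simp
  have h4 : ∑ j : Fin n, ∑ k, (if i = k then T j k else 0) = -∑ k, T i k := by
    rw [← Finset.sum_neg_distrib]
    simp only [Finset.sum_ite_eq, Finset.mem_univ, if_true]
    exact Finset.sum_congr rfl fun j _ => h1 i j
  rw [h3, h4, sub_neg_eq_add, ← two_smul ℂ, smul_smul]
  norm_num

/-- The sign character of `W` as a complex number. -/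
def sgn (w : Equiv.Perm (Fin n)) : ℂ := ((Equiv.Perm.sign w : ℤ) : ℂ)

theorem sgn_mul (v w : Equiv.Perm (Fin n)) : sgn (v * w) = sgn v * sgn w := by
  simp [sgn]

theorem sgn_one : sgn (1 : Equiv.Perm (Fin n)) = 1 := by simp [sgn]

theorem sgn_mul_self (w : Equiv.Perm (Fin n)) : sgn w * sgn w = 1 := by
  rw [sgn, ← Int.cast_mul, ← Units.val_mul, Int.units_mul_self]
  simp

theorem sgn_swap {i k : Fin n} (h : i ≠ k) : sgn (Equiv.swap i k) = -1 := by
  simp [sgn, Equiv.Perm.sign_swap h]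

/-- The sign twist as an algebra endomorphism. -/
def signTwistHom (n : ℕ) (c : ℂ) : HReg n →ₐ[ℂ] HReg n :=
  SkewMonoidAlgebra.liftNCAlgHom ((opHom n).comp (DReg.twist (2 * c)))
    { toFun := fun w => sgn w • perm w
      map_one' := by rw [sgn_one, one_smul, perm_one]
      map_mul' := fun v w => by rw [sgn_mul, perm_mul, smul_mul_smul_comm] }
    (fun {D w} => by
      simp only [AlgHom.comp_apply, MonoidHom.coe_mk, OneHom.coe_mk, opHom_apply,
        DReg.twist_perm_smul, mul_smul_comm, smul_mul_assoc, perm_mul_op])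

theorem signTwistHom_single (c : ℂ) (w : Equiv.Perm (Fin n)) (D : DReg n) :
    signTwistHom n c (SkewMonoidAlgebra.single w D) =
      op (DReg.twist (2 * c) D) * (sgn w • perm w) :=
  SkewMonoidAlgebra.liftNC_single _ _ _ _

theorem signTwistHom_op (c : ℂ) (D : DReg n) :
    signTwistHom n c (op D) = op (DReg.twist (2 * c) D) := by
  rw [op, signTwistHom_single, sgn_one, one_smul, perm_one, mul_one]

@[simp] theorem signTwistHom_fn (c : ℂ) (f : RegFun n) : signTwistHom n c (fn f) = fn f := by
  rw [fn, signTwistHom_op, DReg.twist_ofFun]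

@[simp] theorem signTwistHom_del (c : ℂ) (i : Fin n) :
    signTwistHom n c (del n i) = del n i + (2 * c) • fn (logDer i) := by
  rw [del, signTwistHom_op, DReg.twist_ofDer, op_add, op_smul, fn]

@[simp] theorem signTwistHom_perm (c : ℂ) (w : Equiv.Perm (Fin n)) :
    signTwistHom n c (perm w) = sgn w • perm w := by
  rw [perm, signTwistHom_single, map_one]
  exact one_mul _


theorem signTwistHom_neg_comp (c : ℂ) :
    (signTwistHom n (-c)).comp (signTwistHom n c) = AlgHom.id ℂ (HReg n) := by
  refine hReg_algHom_ext (fun f => by simp) (fun i => ?_) fun w => ?_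
  · simp only [AlgHom.comp_apply, signTwistHom_del, map_add, map_smul, signTwistHom_fn,
      AlgHom.id_apply, add_assoc, ← add_smul]
    simp
  · simp [smul_smul, sgn_mul_self]

/-- The sign twist as an automorphism. -/
def signTwist (n : ℕ) (c : ℂ) : HReg n ≃ₐ[ℂ] HReg n :=
  AlgEquiv.ofAlgHom (signTwistHom n c) (signTwistHom n (-c))
    (by simpa using signTwistHom_neg_comp (n := n) (-c)) (signTwistHom_neg_comp c)

/-- The twist turns `1 - s` into `1 + s = 2 - (1 - s)`; the constants `2` sum to `2c ℓ_i` and cancel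
the term added to `∂_i`. -/
theorem signTwistHom_dunkl (c : ℂ) (i : Fin n) :
    signTwistHom n c (dunkl n c i) = dunkl n (-c) i := by
  rw [dunkl_eq, dunkl_eq]
  simp only [map_sub, map_smul, map_sum, map_mul, map_one, signTwistHom_del, signTwistHom_fn,
    signTwistHom_perm, logDer, fn_sum]
  have h : ∀ k, fn (invDiff i k) * (1 - sgn (Equiv.swap i k) • perm (Equiv.swap i k)) =
      (2 : ℂ) • fn (invDiff i k) - fn (invDiff i k) * (1 - perm (Equiv.swap i k)) := by
    intro k
    rcases eq_or_ne i k with rfl | hk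
    · simp [fn_zero]
    · rw [sgn_swap hk, neg_one_smul, two_smul]
      noncomm_ring
  simp only [h, Finset.sum_sub_distrib, ← Finset.smul_sum]
  module

theorem isSignTwist_signTwistHom (c : ℂ) : IsSignTwist c (signTwistHom n c) where
  map_poly _ := signTwistHom_fn c _
  map_dunkl i := signTwistHom_dunkl c i
  map_perm w := signTwistHom_perm c w

/-- Clear denominators: a power of `δ` is fixed and invertible. -/
theorem IsSignTwist.map_fn {c : ℂ} {φ : HReg n →ₐ[ℂ] HReg n} (h : IsSignTwist c φ)
    (f : RegFun n) : φ (fn f) = fn f := by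
  obtain ⟨⟨p, s⟩, hps⟩ := IsLocalization.surj (Submonoid.powers (disc n)) f
  have hs : IsUnit (algebraMap _ (RegFun n) (s : MvPolynomial (Fin n) ℂ)) :=
    IsLocalization.map_units (RegFun n) s
  have hs' : IsUnit (fn (algebraMap _ (RegFun n) (s : MvPolynomial (Fin n) ℂ)) : HReg n) :=
    hs.map (fnHom n)
  refine hs'.mul_right_cancel ?_
  calc φ (fn f) * fn (algebraMap _ (RegFun n) (s : MvPolynomial (Fin n) ℂ))
      = φ (fn f * fn (algebraMap _ (RegFun n) (s : MvPolynomial (Fin n) ℂ))) := by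
        rw [map_mul, h.map_poly]
    _ = _ := by rw [← fn_mul, hps, h.map_poly]

theorem del_eq (c : ℂ) (i : Fin n) : del n i = dunkl n c i +
    c • ∑ k, fn (invDiff i k) * (1 - perm (Equiv.swap i k)) := by
  rw [dunkl_eq, sub_add_cancel]

/-- `∂_i` is a Dunkl operator plus an expression in functions and reflections, so its image is
forced. -/
theorem IsSignTwist.eq {c : ℂ} {φ : HReg n →ₐ[ℂ] HReg n} (h : IsSignTwist c φ) :
    φ = signTwistHom n c := by
  have hp : ∀ w, φ (perm w) = signTwistHom n c (perm w) := fun w => by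
    rw [h.map_perm, signTwistHom_perm]; rfl
  have hf : ∀ f : RegFun n, φ (fn f) = signTwistHom n c (fn f) := fun f => by
    rw [h.map_fn, signTwistHom_fn]
  refine hReg_algHom_ext hf (fun i => ?_) hp
  rw [del_eq c]
  simp only [map_add, map_smul, map_sum, map_mul, map_sub, map_one, h.map_dunkl,
    signTwistHom_dunkl, hf, hp]

theorem perm_mem_H (c : ℂ) (w : Equiv.Perm (Fin n)) : perm w ∈ H n c :=
  Algebra.subset_adjoin (Or.inl (Or.inl ⟨w, rfl⟩))

theorem coord_mem_H (c : ℂ) (i : Fin n) : fn (coord n i) ∈ H n c :=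
  Algebra.subset_adjoin (Or.inl (Or.inr ⟨i, rfl⟩))

theorem dunkl_mem_H (c : ℂ) (i : Fin n) : dunkl n c i ∈ H n c :=
  Algebra.subset_adjoin (Or.inr ⟨i, rfl⟩)

theorem map_H_le (c : ℂ) : (H n c).map (signTwistHom n c) ≤ H n (-c) := by
  rw [H, AlgHom.map_adjoin]
  refine Algebra.adjoin_le ?_
  rintro _ ⟨_, (⟨w, rfl⟩ | ⟨i, rfl⟩) | ⟨i, rfl⟩, rfl⟩
  · rw [signTwistHom_perm]
    exact Subalgebra.smul_mem _ (perm_mem_H _ w) _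
  · rw [signTwistHom_fn]
    exact coord_mem_H _ i
  · rw [signTwistHom_dunkl]
    exact dunkl_mem_H _ i

theorem map_H (c : ℂ) : (H n c).map (signTwistHom n c) = H n (-c) := by
  refine le_antisymm (map_H_le c) fun z hz => ?_
  refine ⟨signTwistHom n (-c) z, ?_, ?_⟩
  · have := map_H_le (-c) ⟨z, hz, rfl⟩
    rwa [neg_neg] at this
  · have := DFunLike.congr_fun (signTwistHom_neg_comp (n := n) (-c)) z
    rwa [neg_neg] at this

theorem discPow_add (a b : ℤ) : discPow n (a + b) = discPow n a * discPow n b := by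
  rw [discPow, zpow_add, Units.val_mul, fn_mul, discPow, discPow]

theorem discPow_zero : discPow n 0 = 1 := by
  rw [discPow, zpow_zero, Units.val_one, fn_one]

theorem discPow_mul_cancel {a b : ℤ} (h : a + b = 0) : discPow n a * discPow n b = 1 := by
  rw [← discPow_add, h, discPow_zero]

@[simp] theorem signTwistHom_discPow (c : ℂ) (k : ℤ) :
    signTwistHom n c (discPow n k) = discPow n k := signTwistHom_fn _ _

/-- Conjugation by a power of the discriminant. -/
def conjDisc (n : ℕ) (k : ℤ) : HReg n →ₐ[ℂ] HReg n where
  toFun z := discPow n (-k) * z * discPow n k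
  map_one' := by rw [mul_one, discPow_mul_cancel (by ring)]
  map_mul' a b := by
    have h := discPow_mul_cancel (n := n) (a := k) (b := -k) (by ring)
    calc discPow n (-k) * (a * b) * discPow n k
        = discPow n (-k) * a * 1 * b * discPow n k := by simp only [mul_one, mul_assoc]
      _ = _ := by rw [← h]; simp only [mul_assoc]
  map_zero' := by simp
  map_add' a b := by rw [mul_add, add_mul]
  commutes' c := by
    rw [← Algebra.commutes, mul_assoc, discPow_mul_cancel (by ring), mul_one]

theorem conjDisc_apply (k : ℤ) (z : HReg n) :
    conjDisc n k z = discPow n (-k) * z * discPow n k := rfl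

@[simp] theorem conjDisc_fn (k : ℤ) (f : RegFun n) : conjDisc n k (fn f) = fn f := by
  rw [conjDisc_apply, mul_assoc, discPow, discPow, fn_commute f, ← mul_assoc]
  exact (congrArg (· * fn f) (discPow_mul_cancel (n := n) (by ring))).trans (one_mul _)

theorem conjDisc_conjDisc (a b : ℤ) (z : HReg n) :
    conjDisc n a (conjDisc n b z) = conjDisc n (a + b) z := by
  simp only [conjDisc_apply]
  rw [neg_add, discPow_add, add_comm a b, discPow_add]
  simp only [mul_assoc]

theorem conjDisc_zero (z : HReg n) : conjDisc n 0 z = z := by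
  rw [conjDisc_apply, neg_zero, discPow_zero, one_mul, mul_one]

@[simp] theorem conjDisc_one_del (i : Fin n) :
    conjDisc n 1 (del n i) = del n i + fn (logDer i) := by
  rw [conjDisc_apply, discPow, discPow, mul_assoc, del_mul_fn, zpow_one, partialDer_discUnit,
    mul_comm (logDer i), fn_mul, ← mul_add, ← mul_assoc, ← fn_mul, zpow_neg_one,
    Units.inv_mul, fn_one, one_mul]

theorem permHom_discUnit (w : Equiv.Perm (Fin n)) :
    permHom n w (discUnit n) = sgn w • (discUnit n : RegFun n) := by
  rw [coe_discUnit, map_prod]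
  simp only [map_prod, map_sub, permHom_coord]
  rw [sgn, Algebra.smul_def, map_intCast]
  exact w.prod_Ioi_comp_eq_sign_mul_prod (f := fun i j => coord n i - coord n j)
    fun i j => (neg_sub _ _).symm

theorem perm_mul_discPow_one (w : Equiv.Perm (Fin n)) :
    perm w * discPow n 1 = sgn w • (discPow n 1 * perm w) := by
  rw [discPow, zpow_one, perm_mul_fn, permHom_discUnit, ← fnHom_apply, map_smul, fnHom_apply,
    smul_mul_assoc]

@[simp] theorem conjDisc_one_perm (w : Equiv.Perm (Fin n)) :
    conjDisc n 1 (perm w) = sgn w • perm w := by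
  rw [conjDisc_apply, mul_assoc, perm_mul_discPow_one, mul_smul_comm, ← mul_assoc,
    discPow_mul_cancel (by ring), one_mul]

/-- Conjugation by `δ` adds `ℓ_i` to `∂_i` and multiplies `w` by its sign; done twice, it adds `2
ℓ_i` and fixes `w`. -/
theorem signTwistHom_add_one (c : ℂ) :
    signTwistHom n (c + 1) = (conjDisc n 2).comp (signTwistHom n c) := by
  have h2 : ∀ z : HReg n, conjDisc n 2 z = conjDisc n 1 (conjDisc n 1 z) := fun z => by
    rw [conjDisc_conjDisc]; norm_num
  refine hReg_algHom_ext (fun f => by simp) (fun i => ?_) fun w => ?_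
  · simp only [AlgHom.comp_apply, h2, signTwistHom_del, map_add, map_smul, conjDisc_one_del,
      conjDisc_fn]
    module
  · simp only [AlgHom.comp_apply, h2, signTwistHom_perm, map_smul, conjDisc_one_perm, smul_smul,
      sgn_mul_self, one_mul]

theorem signTwistHom_add_natCast (c : ℂ) (j : ℕ) (z : HReg n) :
    signTwistHom n (c + j) z = conjDisc n (2 * j) (signTwistHom n c z) := by
  induction j with
  | zero => simp [conjDisc_zero]
  | succ j ih =>
    rw [Nat.cast_succ, ← add_assoc, signTwistHom_add_one, AlgHom.comp_apply, ih,
      conjDisc_conjDisc]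
    push_cast
    congr 2
    ring

end Cherednik

/-! ### Commutation relations of the Dunkl operators. -/

namespace Cherednik

variable {n : ℕ}

theorem perm_mul_dunkl (c : ℂ) (w : Equiv.Perm (Fin n)) (i : Fin n) :
    perm w * dunkl n c i = dunkl n c (w i) * perm w := by
  have h : ∀ k, perm w * (fn (invDiff i k) * (1 - perm (Equiv.swap i k))) =
      fn (invDiff (w i) (w k)) * (1 - perm (Equiv.swap (w i) (w k))) * perm w := by
    intro k
    rw [← mul_assoc, perm_mul_fn, permHom_invDiff, mul_assoc, mul_assoc, mul_sub, sub_mul,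
      ← perm_mul, ← perm_mul, Equiv.mul_swap_eq_swap_mul, mul_one, one_mul]
  rw [dunkl_eq, dunkl_eq, mul_sub, sub_mul, perm_mul_del, mul_smul_comm, smul_mul_assoc,
    Finset.mul_sum, Finset.sum_mul,
    ← Equiv.sum_comp w fun k => fn (invDiff (w i) k) * (1 - perm (Equiv.swap (w i) k)) * perm w]
  simp only [h]

theorem dunkl_commute_perm_swap (c : ℂ) {i j k : Fin n} (hj : i ≠ j) (hk : i ≠ k) :
    dunkl n c i * perm (Equiv.swap j k) = perm (Equiv.swap j k) * dunkl n c i := by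
  rw [perm_mul_dunkl, Equiv.swap_apply_of_ne_of_ne hj hk]

theorem dunkl_add_commute_perm_swap (c : ℂ) (i j : Fin n) :
    (dunkl n c i + dunkl n c j) * perm (Equiv.swap i j) =
      perm (Equiv.swap i j) * (dunkl n c i + dunkl n c j) := by
  rw [mul_add, perm_mul_dunkl, perm_mul_dunkl, Equiv.swap_apply_left, Equiv.swap_apply_right,
    add_mul, add_comm]

theorem reflection_commutator_coord (i k j : Fin n) :
    fn (invDiff i k) * (1 - perm (Equiv.swap i k)) * fn (coord n j) -
      fn (coord n j) * (fn (invDiff i k) * (1 - perm (Equiv.swap i k))) =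
    fn (invDiff i k * (coord n j - coord n (Equiv.swap i k j))) * perm (Equiv.swap i k) := by
  rw [← mul_assoc (fn (coord n j)), fn_commute (coord n j), mul_assoc, mul_assoc, ← mul_sub,
    sub_mul, perm_mul_fn, permHom_coord, fn_mul, mul_assoc, fn_sub, sub_mul]
  congr 1
  noncomm_ring

theorem dunkl_commutator_coord_of_ne (c : ℂ) {i j : Fin n} (h : i ≠ j) :
    dunkl n c i * fn (coord n j) - fn (coord n j) * dunkl n c i = c • perm (Equiv.swap i j) := by
  have h1 : dunkl n c i * fn (coord n j) - fn (coord n j) * dunkl n c i =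
      (del n i * fn (coord n j) - fn (coord n j) * del n i) - c • ∑ k,
      (fn (invDiff i k) * (1 - perm (Equiv.swap i k)) * fn (coord n j) -
      fn (coord n j) * (fn (invDiff i k) * (1 - perm (Equiv.swap i k)))) := by
    rw [dunkl_eq, sub_mul, mul_sub, Finset.sum_sub_distrib, ← Finset.sum_mul, ← Finset.mul_sum,
      smul_mul_assoc, mul_smul_comm, smul_sub]
    abel
  rw [h1, del_mul_fn, partialDer_coord, if_neg h.symm, fn_zero, add_zero, sub_self, zero_sub]
  simp only [reflection_commutator_coord]
  rw [Finset.sum_eq_single j]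
  · rw [Equiv.swap_apply_right, ← neg_sub (coord n i), mul_comm, neg_mul, mul_invDiff h, fn_neg,
      fn_one, neg_mul, one_mul, smul_neg, neg_neg]
  · intro k _ hk
    rw [Equiv.swap_apply_of_ne_of_ne h.symm hk.symm, sub_self, mul_zero, fn_zero, zero_mul]
  · simp

theorem dunkl_commutator_coord_self (c : ℂ) (i : Fin n) :
    dunkl n c i * fn (coord n i) - fn (coord n i) * dunkl n c i =
      1 - c • ∑ k ∈ Finset.univ.erase i, perm (Equiv.swap i k) := by
  have h1 : dunkl n c i * fn (coord n i) - fn (coord n i) * dunkl n c i =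
      (del n i * fn (coord n i) - fn (coord n i) * del n i) - c • ∑ k,
      (fn (invDiff i k) * (1 - perm (Equiv.swap i k)) * fn (coord n i) -
      fn (coord n i) * (fn (invDiff i k) * (1 - perm (Equiv.swap i k)))) := by
    rw [dunkl_eq, sub_mul, mul_sub, Finset.sum_sub_distrib, ← Finset.sum_mul, ← Finset.mul_sum,
      smul_mul_assoc, mul_smul_comm, smul_sub]
    abel
  rw [h1, del_mul_fn, partialDer_coord, if_pos rfl, fn_one, add_sub_cancel_left]
  simp only [reflection_commutator_coord]
  congr 2
  rw [← Finset.sum_erase_add _ _ (Finset.mem_univ i), invDiff_self, zero_mul, fn_zero, zero_mul,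
    add_zero]
  refine Finset.sum_congr rfl fun k hk => ?_
  rw [Equiv.swap_apply_left, mul_comm, mul_invDiff (Finset.ne_of_mem_erase hk).symm, fn_one,
    one_mul]

/-- The action of the skew group ring on functions. -/
def actHom (n : ℕ) : HReg n →ₐ[ℂ] Module.End ℂ (RegFun n) :=
  SkewMonoidAlgebra.liftNCAlgHom ((diffOps (RegFun n)).val : DReg n →ₐ[ℂ] _)
    { toFun := fun w => (permHom n w).toLinearMap
      map_one' := by rw [permHom_one]; rfl
      map_mul' := fun v w => by rw [permHom_mul]; rfl }
    (fun {D w} => LinearMap.ext fun f => by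
      change (w • D).act (permHom n w f) = permHom n w (D.act f)
      rw [DReg.val_perm_smul, permHom_inv_apply'])

theorem actHom_single (w : Equiv.Perm (Fin n)) (D : DReg n) (f : RegFun n) :
    actHom n (SkewMonoidAlgebra.single w D) f = D.act (permHom n w f) := by
  have h : actHom n (SkewMonoidAlgebra.single w D) =
      D.act * (permHom n w).toLinearMap := SkewMonoidAlgebra.liftNC_single _ _ _ _
  rw [h]
  rfl

theorem actHom_op (D : DReg n) (f : RegFun n) : actHom n (op D) f = D.act f := by
  rw [op, actHom_single, permHom_one]
  rfl

theorem actHom_dunkl_one (c : ℂ) (i : Fin n) : actHom n (dunkl n c i) 1 = 0 := by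
  have h : ∀ w : Equiv.Perm (Fin n), actHom n (1 - perm w) 1 = 0 := fun w => by
    rw [map_sub, LinearMap.sub_apply, map_one (actHom n), perm, actHom_single,
      map_one (permHom n w)]
    exact sub_self _
  rw [dunkl_eq, map_sub, map_smul, map_sum, LinearMap.sub_apply, LinearMap.smul_apply,
    LinearMap.sum_apply, del, actHom_op, DReg.val_ofDer, Derivation.map_one_eq_zero]
  simp only [map_mul, Module.End.mul_apply, h, map_zero, Finset.sum_const_zero, smul_zero,
    sub_zero]

/-- A differential operator that commutes with the coordinates and kills `1` is zero. -/
theorem DReg.eq_zero_of_commute {D : DReg n}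
    (h : ∀ i, D * DReg.ofFun (coord n i) = DReg.ofFun (coord n i) * D) (h1 : D.act 1 = 0) :
    D = 0 := by
  have hp : ∀ p : MvPolynomial (Fin n) ℂ,
      D * DReg.ofFun (algebraMap _ (RegFun n) p) = DReg.ofFun (algebraMap _ (RegFun n) p) * D := by
    intro p
    induction p using MvPolynomial.induction_on with
    | C a =>
      rw [← MvPolynomial.algebraMap_eq, ← IsScalarTower.algebraMap_apply, ← DReg.funHom_apply,
        AlgHom.commutes]
      exact (Algebra.commutes a D).symm
    | add p q hp hq => rw [map_add, DReg.ofFun_add, mul_add, add_mul, hp, hq]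
    | mul_X p i hp =>
      rw [map_mul, DReg.ofFun_mul, ← mul_assoc, hp, mul_assoc, mul_assoc]
      congr 1
      exact h i
  refine DReg.ext' fun f => ?_
  obtain ⟨⟨p, s⟩, hps⟩ := IsLocalization.surj (Submonoid.powers (disc n)) f
  have hs : IsUnit (algebraMap _ (RegFun n) (s : MvPolynomial (Fin n) ℂ)) :=
    IsLocalization.map_units (RegFun n) s
  have h2 := congrArg (fun E : DReg n => E.act f) (hp s)
  have h3 := congrArg (fun E : DReg n => E.act 1) (hp p)
  simp only [DReg.val_mul, DReg.val_ofFun, mul_one, h1, mul_zero] at h2 h3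
  rw [mul_comm, hps, h3] at h2
  rw [DReg.val_zero]
  exact hs.mul_left_cancel (by rw [← h2, mul_zero])

/-- The commutator `Z` of two Dunkl operators commutes with all coordinates, by the Jacobi identity.
This kills its components at `w ≠ 1` and makes the component at `1` a multiplication by a function,
which is zero because Dunkl operators annihilate `1`. -/
theorem dunkl_commute (c : ℂ) (i j : Fin n) :
    dunkl n c i * dunkl n c j = dunkl n c j * dunkl n c i := by
  rcases eq_or_ne i j with rfl | hij
  · rfl
  set Z := dunkl n c i * dunkl n c j - dunkl n c j * dunkl n c i with hZ
  have jac : ∀ (a b x : HReg n), (a * b - b * a) * x - x * (a * b - b * a) =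
      (a * (b * x - x * b) - (b * x - x * b) * a) -
      (b * (a * x - x * a) - (a * x - x * a) * b) := fun a b x => by noncomm_ring
  -- By Jacobi this bracket is `-c` times the commutator of `D_a + D_b` with `s_{ab}`, which
  -- vanishes by symmetry.
  have aux : ∀ a b : Fin n, a ≠ b →
      (dunkl n c a * dunkl n c b - dunkl n c b * dunkl n c a) * fn (coord n b) -
      fn (coord n b) * (dunkl n c a * dunkl n c b - dunkl n c b * dunkl n c a) = 0 := by
    intro a b hab
    rw [jac, dunkl_commutator_coord_of_ne c hab, dunkl_commutator_coord_self]
    have h1 : ∑ k ∈ Finset.univ.erase b, dunkl n c a * perm (Equiv.swap b k) -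
        ∑ k ∈ Finset.univ.erase b, perm (Equiv.swap b k) * dunkl n c a =
        dunkl n c a * perm (Equiv.swap a b) - perm (Equiv.swap a b) * dunkl n c a := by
      rw [← Finset.sum_sub_distrib, Finset.sum_eq_single a]
      · rw [Equiv.swap_comm]
      · intro k _ hk
        rw [dunkl_commute_perm_swap c hab hk.symm, sub_self]
      · intro h
        exact absurd (Finset.mem_erase.2 ⟨hab, Finset.mem_univ _⟩) h
    have h2 := dunkl_add_commute_perm_swap c a b
    rw [add_mul, mul_add] at h2
    simp only [mul_sub, sub_mul, mul_one, one_mul, mul_smul_comm, smul_mul_assoc,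
      Finset.mul_sum, Finset.sum_mul]
    have h3 : ∀ (d s t p q r v : HReg n), s - t = p - q → p + r = q + v →
        d - c • s - (d - c • t) - (c • r - c • v) = 0 := by
      intro d s t p q r v h h'
      have : d - c • s - (d - c • t) - (c • r - c • v) = -(c • ((s - t) + r - v)) := by module
      rw [this, h, sub_add_eq_add_sub, h', add_sub_cancel_left, sub_self, smul_zero, neg_zero]
    exact h3 _ _ _ _ _ _ _ h1 h2
  have hcomm : ∀ k, Z * fn (coord n k) = fn (coord n k) * Z := by
    intro k
    rw [← sub_eq_zero]
    rcases eq_or_ne k j with rfl | hkj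
    · exact aux i k hij
    rcases eq_or_ne k i with rfl | hki
    · have := aux j k hij.symm
      rw [hZ, ← neg_sub (dunkl n c j * dunkl n c k), neg_mul, mul_neg, ← neg_sub', this, neg_zero]
    · rw [hZ, jac, dunkl_commutator_coord_of_ne c hkj.symm, dunkl_commutator_coord_of_ne c hki.symm,
        mul_smul_comm, smul_mul_assoc, mul_smul_comm, smul_mul_assoc,
        dunkl_commute_perm_swap c hij hki.symm, dunkl_commute_perm_swap c hij.symm hkj.symm]
      simp
  -- Moving `x_k` past `w` turns it into `x_{w(k)}`: the component at `w` intertwines two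
  -- coordinates, distinct for some `k` unless `w = 1`.
  have hcoeff : ∀ w k, Z.coeff w * DReg.ofFun (coord n (w k)) =
      DReg.ofFun (coord n k) * Z.coeff w := by
    intro w k
    have := congrArg (fun z : HReg n => z.coeff w) (hcomm k)
    simp only [fn, op] at this
    rwa [SkewMonoidAlgebra.coeff_mul_single_one, SkewMonoidAlgebra.coeff_single_one_mul,
      DReg.smul_ofFun, permHom_coord] at this
  have hne : ∀ w, w ≠ 1 → Z.coeff w = 0 := by
    intro w hw
    obtain ⟨k, hk⟩ := not_forall.1 fun h => hw (Equiv.ext h)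
    exact DReg.eq_zero_of_intertwines hk (hcoeff w k)
  have hZop : Z = op (Z.coeff 1) := by
    refine SkewMonoidAlgebra.ext fun w => ?_
    rw [op, SkewMonoidAlgebra.coeff_single_apply]
    split_ifs with h
    · rw [h]
    · exact hne w (Ne.symm h)
  have hact : (Z.coeff 1).act 1 = 0 := by
    rw [← actHom_op, ← hZop, hZ, map_sub, map_mul, map_mul]
    simp [actHom_dunkl_one]
  have h0 : Z.coeff 1 = 0 := DReg.eq_zero_of_commute (fun i => hcoeff 1 i) hact
  rw [← sub_eq_zero, ← hZ, hZop, h0]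
  exact map_zero (opHom n)

end Cherednik

/-! ### Generators of the spherical subalgebra, from the Cherednik relations alone. -/

namespace Cherednik

open MvPolynomial in
/-- The defining relations of the rational Cherednik algebra of type `A`, for two commuting
families `x_i`, `y_i` (given as maps from polynomial rings) and a copy of `W` in an algebra. -/
structure Relations {n : ℕ} {A : Type*} [Ring A] [Algebra ℂ A]
    (x y : MvPolynomial (Fin n) ℂ →ₐ[ℂ] A) (ρ : Equiv.Perm (Fin n) →* A) (c : ℂ) : Prop where
  perm_x : ∀ w i, ρ w * x (X i) = x (X (w i)) * ρ w
  perm_y : ∀ w i, ρ w * y (X i) = y (X (w i)) * ρ w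
  comm_ne : ∀ {i j}, i ≠ j → y (X i) * x (X j) - x (X j) * y (X i) = c • ρ (Equiv.swap i j)
  comm_self : ∀ i, y (X i) * x (X i) - x (X i) * y (X i) =
    1 - c • ∑ k ∈ Finset.univ.erase i, ρ (Equiv.swap i k)

namespace Relations

open MvPolynomial

variable {n : ℕ} {A : Type*} [Ring A] [Algebra ℂ A]
  {x y : MvPolynomial (Fin n) ℂ →ₐ[ℂ] A} {ρ : Equiv.Perm (Fin n) →* A} {c : ℂ}

variable (x ρ) in
/-- The subalgebra generated by `W` and the `x_i`. -/
def degZero : Subalgebra ℂ A :=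
  Algebra.adjoin ℂ (Set.range ρ ∪ Set.range fun i => x (X i))

variable (y) in
/-- The span of `1` and the `y_i`. -/
def degOne : Submodule ℂ A := Submodule.span ℂ (insert 1 (Set.range fun i => y (X i)))

variable (x y ρ) in
/-- The filtration by the degree in the `y_i`. -/
def filt (d : ℕ) : Submodule ℂ A := (degZero x ρ).toSubmodule * degOne y ^ d

variable (ρ) in
/-- The average over the group. -/
def avg : A := (1 / (Fintype.card (Equiv.Perm (Fin n)) : ℂ)) • ∑ w, ρ w

theorem perm_mem (w : Equiv.Perm (Fin n)) : ρ w ∈ degZero x ρ :=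
  Algebra.subset_adjoin (Or.inl ⟨w, rfl⟩)

theorem x_mem (p : MvPolynomial (Fin n) ℂ) : x p ∈ degZero x ρ := by
  induction p using MvPolynomial.induction_on with
  | C a =>
    rw [← algebraMap_eq, AlgHom.commutes]
    exact Subalgebra.algebraMap_mem _ a
  | add p q hp hq =>
    rw [map_add]
    exact add_mem hp hq
  | mul_X p i hp =>
    rw [map_mul]
    exact mul_mem hp (Algebra.subset_adjoin (Or.inr ⟨i, rfl⟩))

theorem one_mem_degOne : (1 : A) ∈ degOne y := Submodule.subset_span (Set.mem_insert _ _)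

theorem y_mem (i : Fin n) : y (X i) ∈ degOne y :=
  Submodule.subset_span (Set.mem_insert_of_mem _ ⟨i, rfl⟩)

theorem degOne_pow_mono {a b : ℕ} (h : a ≤ b) : degOne y ^ a ≤ degOne y ^ b := by
  obtain ⟨k, rfl⟩ := Nat.exists_eq_add_of_le h
  rw [pow_add]
  intro z hz
  have h1 := Submodule.pow_mem_pow _ (one_mem_degOne (y := y)) k
  rw [one_pow] at h1
  simpa using Submodule.mul_mem_mul hz h1

theorem filt_mono {a b : ℕ} (h : a ≤ b) : filt x y ρ a ≤ filt x y ρ b :=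
  mul_le_mul' le_rfl (degOne_pow_mono h)

theorem mem_filt_of_degZero {z : A} (h : z ∈ degZero x ρ) (d : ℕ) : z ∈ filt x y ρ d := by
  refine filt_mono (Nat.zero_le d) ?_
  rw [filt, pow_zero, mul_one]
  exact h

theorem mem_filt_of_pow {z : A} {d : ℕ} (h : z ∈ degOne y ^ d) : z ∈ filt x y ρ d := by
  have h1 : (1 : A) ∈ (degZero x ρ).toSubmodule := one_mem (degZero x ρ)
  have := Submodule.mul_mem_mul h1 h
  rwa [one_mul] at this

theorem degZero_mul_self :
    (degZero x ρ).toSubmodule * (degZero x ρ).toSubmodule = (degZero x ρ).toSubmodule :=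
  Subalgebra.isIdempotentElem_toSubmodule (degZero x ρ)

theorem y_monomial_mem (b : Fin n →₀ ℕ) : y (monomial b 1) ∈ degOne y ^ b.degree := by
  induction b using Finsupp.induction_linear with
  | zero =>
    rw [map_zero, pow_zero, show (monomial (0 : Fin n →₀ ℕ) (1 : ℂ)) = 1 from rfl, map_one]
    exact Submodule.one_le.1 le_rfl
  | add f g hf hg =>
    have : (monomial (f + g) (1 : ℂ)) = monomial f 1 * monomial g 1 := by simp
    rw [this, map_mul, map_add, pow_add]
    exact Submodule.mul_mem_mul hf hg
  | single i k =>
    rw [← X_pow_eq_monomial, map_pow, Finsupp.degree_single]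
    exact Submodule.pow_mem_pow _ (y_mem i) k

theorem y_pow_mem (i : Fin n) (k : ℕ) : y (X i) ^ k ∈ degOne y ^ k :=
  Submodule.pow_mem_pow _ (y_mem i) k

theorem commutator_mem (R : Relations x y ρ c) (i j : Fin n) :
    y (X i) * x (X j) - x (X j) * y (X i) ∈ degZero x ρ := by
  rcases eq_or_ne i j with rfl | h
  · rw [R.comm_self]
    exact sub_mem (one_mem _) (Subalgebra.smul_mem _ (sum_mem fun k _ => perm_mem _) c)
  · rw [R.comm_ne h]
    exact Subalgebra.smul_mem _ (perm_mem _) c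

theorem perm_mul_x (R : Relations x y ρ c) (w : Equiv.Perm (Fin n)) (p : MvPolynomial (Fin n) ℂ) :
    ρ w * x p = x (rename w p) * ρ w := by
  induction p using MvPolynomial.induction_on with
  | C a => rw [rename_C, ← algebraMap_eq, AlgHom.commutes, Algebra.commutes]
  | add p q hp hq => rw [map_add, map_add, map_add, mul_add, add_mul, hp, hq]
  | mul_X p i hp =>
    rw [map_mul, map_mul, map_mul, rename_X, ← mul_assoc, hp, mul_assoc, R.perm_x, mul_assoc]

theorem perm_mul_y (R : Relations x y ρ c) (w : Equiv.Perm (Fin n)) (p : MvPolynomial (Fin n) ℂ) :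
    ρ w * y p = y (rename w p) * ρ w := by
  induction p using MvPolynomial.induction_on with
  | C a => rw [rename_C, ← algebraMap_eq, AlgHom.commutes, Algebra.commutes]
  | add p q hp hq => rw [map_add, map_add, map_add, mul_add, add_mul, hp, hq]
  | mul_X p i hp =>
    rw [map_mul, map_mul, map_mul, rename_X, ← mul_assoc, hp, mul_assoc, R.perm_y, mul_assoc]

/-- Moving a `y_i` to the right past a group element permutes the index, and past an `x_j` it leaves
a term of degree zero. This makes the filtration multiplicative. -/
theorem degOne_mul_degZero_le (R : Relations x y ρ c) :
    degOne y * (degZero x ρ).toSubmodule ≤ (degZero x ρ).toSubmodule * degOne y := by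
  have hgen : ∀ t ∈ degOne y, ∀ k ∈ Set.range ρ ∪ Set.range (fun i => x (X i)),
      t * k ∈ (degZero x ρ).toSubmodule * degOne y := by
    intro t ht k hk
    have hkK : k ∈ degZero x ρ := Algebra.subset_adjoin hk
    induction ht using Submodule.span_induction with
    | zero => rw [zero_mul]; exact zero_mem _
    | add t t' _ _ h h' => rw [add_mul]; exact add_mem h h'
    | smul a t _ h => rw [smul_mul_assoc]; exact Submodule.smul_mem _ _ h
    | mem t ht =>
      rcases ht with rfl | ⟨i, rfl⟩
      · rw [one_mul, ← mul_one k]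
        exact Submodule.mul_mem_mul hkK one_mem_degOne
      rcases hk with ⟨w, rfl⟩ | ⟨j, rfl⟩
      · have := R.perm_y w (w⁻¹ i)
        rw [show w (w⁻¹ i) = i from w.apply_symm_apply i] at this
        change y (X i) * ρ w ∈ _
        rw [← this]
        exact Submodule.mul_mem_mul (perm_mem w) (y_mem _)
      · change y (X i) * x (X j) ∈ _
        rw [← sub_add_cancel (y (X i) * x (X j)) (x (X j) * y (X i))]
        refine add_mem ?_ (Submodule.mul_mem_mul (x_mem _) (y_mem i))
        rw [← mul_one (y (X i) * x (X j) - x (X j) * y (X i))]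
        exact Submodule.mul_mem_mul (R.commutator_mem i j) one_mem_degOne
  have key : ∀ k ∈ degZero x ρ, ∀ z ∈ (degZero x ρ).toSubmodule * degOne y,
      z * k ∈ (degZero x ρ).toSubmodule * degOne y := by
    intro k hk
    induction hk using Algebra.adjoin_induction with
    | mem k hk =>
      intro z hz
      induction hz using Submodule.mul_induction_on' with
      | mem_mul_mem a ha t ht =>
        rw [mul_assoc]
        have := Submodule.mul_mem_mul ha (hgen t ht k hk)
        rwa [← mul_assoc (degZero x ρ).toSubmodule, degZero_mul_self] at this
      | add a _ b _ ha hb => rw [add_mul]; exact add_mem ha hb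
    | algebraMap r =>
      intro z hz
      rw [← Algebra.commutes, ← Algebra.smul_def]
      exact Submodule.smul_mem _ _ hz
    | add a b _ _ ha hb =>
      intro z hz
      rw [mul_add]
      exact add_mem (ha z hz) (hb z hz)
    | mul a b _ _ ha hb =>
      intro z hz
      rw [← mul_assoc]
      exact hb _ (ha z hz)
  refine Submodule.mul_le.2 fun t ht k hk => key k hk t ?_
  rw [← one_mul t]
  exact Submodule.mul_mem_mul (one_mem _ : (1 : A) ∈ degZero x ρ) ht

theorem pow_mul_degZero_le (R : Relations x y ρ c) (d : ℕ) :
    degOne y ^ d * (degZero x ρ).toSubmodule ≤ filt x y ρ d := by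
  induction d with
  | zero => rw [filt, pow_zero, one_mul, mul_one]
  | succ d ih =>
    calc degOne y ^ (d + 1) * (degZero x ρ).toSubmodule
        = degOne y ^ d * (degOne y * (degZero x ρ).toSubmodule) := by rw [pow_succ, mul_assoc]
      _ ≤ degOne y ^ d * ((degZero x ρ).toSubmodule * degOne y) :=
        mul_le_mul' le_rfl R.degOne_mul_degZero_le
      _ = (degOne y ^ d * (degZero x ρ).toSubmodule) * degOne y := by rw [mul_assoc]
      _ ≤ filt x y ρ d * degOne y := mul_le_mul' ih le_rfl
      _ = filt x y ρ (d + 1) := by rw [filt, filt, mul_assoc, pow_succ]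

theorem filt_mul_filt_le (R : Relations x y ρ c) (a b : ℕ) : filt x y ρ a * filt x y ρ b ≤ filt x y ρ (a + b) := by
  calc filt x y ρ a * filt x y ρ b
      = (degZero x ρ).toSubmodule * (degOne y ^ a * (degZero x ρ).toSubmodule) * degOne y ^ b := by
        simp only [filt, mul_assoc]
    _ ≤ (degZero x ρ).toSubmodule * ((degZero x ρ).toSubmodule * degOne y ^ a) * degOne y ^ b :=
        mul_le_mul' (mul_le_mul' le_rfl (R.pow_mul_degZero_le a)) le_rfl
    _ = filt x y ρ (a + b) := by
        rw [← mul_assoc, degZero_mul_self, filt, pow_add, mul_assoc]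

theorem mul_mem_filt (R : Relations x y ρ c) {a b : ℕ} {z z' : A} (h : z ∈ filt x y ρ a) (h' : z' ∈ filt x y ρ b) :
    z * z' ∈ filt x y ρ (a + b) :=
  R.filt_mul_filt_le a b (Submodule.mul_mem_mul h h')

theorem exists_mem_filt (R : Relations x y ρ c) {z : A} (hz : z ∈ Algebra.adjoin ℂ
    (Set.range ρ ∪ (Set.range fun i => x (X i)) ∪ Set.range fun i => y (X i))) :
    ∃ d, z ∈ filt x y ρ d := by
  induction hz using Algebra.adjoin_induction with
  | mem z hz =>
    rcases hz with hz | ⟨i, rfl⟩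
    · exact ⟨0, mem_filt_of_degZero (Algebra.subset_adjoin hz) 0⟩
    · exact ⟨1, mem_filt_of_pow (by rw [pow_one]; exact y_mem i)⟩
  | algebraMap r => exact ⟨0, mem_filt_of_degZero (Subalgebra.algebraMap_mem _ r) 0⟩
  | add a b _ _ ha hb =>
    obtain ⟨d, hd⟩ := ha
    obtain ⟨d', hd'⟩ := hb
    exact ⟨max d d', add_mem (filt_mono (le_max_left _ _) hd) (filt_mono (le_max_right _ _) hd')⟩
  | mul a b _ _ ha hb =>
    obtain ⟨d, hd⟩ := ha
    obtain ⟨d', hd'⟩ := hb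
    exact ⟨d + d', R.mul_mem_filt hd hd'⟩

theorem y_commutator_x_mem (R : Relations x y ρ c) (i : Fin n) (p : MvPolynomial (Fin n) ℂ) :
    y (X i) * x p - x p * y (X i) ∈ degZero x ρ := by
  induction p using MvPolynomial.induction_on with
  | C a =>
    rw [← algebraMap_eq, AlgHom.commutes, Algebra.commutes, sub_self]
    exact zero_mem _
  | add p q hp hq =>
    rw [map_add, mul_add, add_mul, add_sub_add_comm]
    exact add_mem hp hq
  | mul_X p j hp =>
    have : y (X i) * x (p * X j) - x (p * X j) * y (X i) =
        (y (X i) * x p - x p * y (X i)) * x (X j) +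
          x p * (y (X i) * x (X j) - x (X j) * y (X i)) := by
      rw [map_mul]; noncomm_ring
    rw [this]
    exact add_mem (mul_mem hp (x_mem _)) (mul_mem (x_mem _) (R.commutator_mem i j))

theorem y_pow_commutator_x_mem (R : Relations x y ρ c) (i : Fin n) (b : ℕ) (p : MvPolynomial (Fin n) ℂ) :
    y (X i) ^ (b + 1) * x p - x p * y (X i) ^ (b + 1) ∈ filt x y ρ b := by
  induction b with
  | zero =>
    rw [zero_add, pow_one]
    exact mem_filt_of_degZero (R.y_commutator_x_mem i p) 0
  | succ b ih =>
    have : y (X i) ^ (b + 1 + 1) * x p - x p * y (X i) ^ (b + 1 + 1) =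
        y (X i) * (y (X i) ^ (b + 1) * x p - x p * y (X i) ^ (b + 1)) +
          (y (X i) * x p - x p * y (X i)) * y (X i) ^ (b + 1) := by
      rw [pow_succ' _ (b + 1)]; noncomm_ring
    rw [this]
    refine add_mem ?_ ?_
    · have := R.mul_mem_filt (mem_filt_of_pow (d := 1) (by rw [pow_one]; exact y_mem i)) ih
      rwa [add_comm 1 b] at this
    · exact Submodule.mul_mem_mul (R.y_commutator_x_mem i p) (y_pow_mem i (b + 1))

/-- The reflection terms from the brackets with `y_j`, `j ≠ k`, cancel those from the bracket with
`y_k`, so the answer is the one for `c = 0`. -/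
theorem laplacian_commutator_x (R : Relations x y ρ c) (k : Fin n) :
    (∑ j, y (X j) ^ 2) * x (X k) - x (X k) * ∑ j, y (X j) ^ 2 = (2 : ℂ) • y (X k) := by
  have h : ∀ j, y (X j) ^ 2 * x (X k) - x (X k) * y (X j) ^ 2 =
      y (X j) * (y (X j) * x (X k) - x (X k) * y (X j)) +
        (y (X j) * x (X k) - x (X k) * y (X j)) * y (X j) := fun j => by
    rw [pow_two]; noncomm_ring
  rw [Finset.sum_mul, Finset.mul_sum, ← Finset.sum_sub_distrib]
  simp only [h]
  rw [← Finset.add_sum_erase _ _ (Finset.mem_univ k), R.comm_self]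
  have h1 : ∑ j ∈ Finset.univ.erase k, (y (X j) * (y (X j) * x (X k) - x (X k) * y (X j)) +
        (y (X j) * x (X k) - x (X k) * y (X j)) * y (X j)) =
      c • ∑ j ∈ Finset.univ.erase k,
        (y (X k) * ρ (Equiv.swap k j) + ρ (Equiv.swap k j) * y (X k)) := by
    rw [Finset.smul_sum]
    refine Finset.sum_congr rfl fun j hj => ?_
    have hjk := Finset.ne_of_mem_erase hj
    have e1 := R.perm_y (Equiv.swap k j) k
    have e2 := R.perm_y (Equiv.swap k j) j
    rw [Equiv.swap_apply_left] at e1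
    rw [Equiv.swap_apply_right] at e2
    rw [R.comm_ne hjk, Equiv.swap_comm j k, mul_smul_comm, smul_mul_assoc, e1, e2, ← smul_add,
      add_comm]
  rw [h1, Finset.sum_add_distrib, ← Finset.mul_sum, ← Finset.sum_mul]
  simp only [mul_sub, sub_mul, mul_one, one_mul, mul_smul_comm, smul_mul_assoc]
  module

theorem laplacian_commutator_x_pow (R : Relations x y ρ c) (k : Fin n) (a : ℕ) :
    (∑ j, y (X j) ^ 2) * x (X k) ^ (a + 1) - x (X k) ^ (a + 1) * ∑ j, y (X j) ^ 2 -
      (2 * (a + 1) : ℂ) • (x (X k) ^ a * y (X k)) ∈ degZero x ρ := by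
  induction a with
  | zero =>
    rw [zero_add, pow_one, R.laplacian_commutator_x]
    simp
  | succ a ih =>
    set E := ∑ j, y (X j) ^ 2
    have h := R.laplacian_commutator_x k
    have : E * x (X k) ^ (a + 1 + 1) - x (X k) ^ (a + 1 + 1) * E -
        (2 * ((a + 1 : ℕ) + 1) : ℂ) • (x (X k) ^ (a + 1) * y (X k)) =
        (E * x (X k) ^ (a + 1) - x (X k) ^ (a + 1) * E -
          (2 * (a + 1) : ℂ) • (x (X k) ^ a * y (X k))) * x (X k) +
        (2 * (a + 1) : ℂ) • (x (X k) ^ a * (y (X k) * x (X k) - x (X k) * y (X k))) := by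
      have e1 : E * x (X k) ^ (a + 1 + 1) - x (X k) ^ (a + 1 + 1) * E =
          (E * x (X k) ^ (a + 1) - x (X k) ^ (a + 1) * E) * x (X k) +
            (2 : ℂ) • (x (X k) ^ (a + 1) * y (X k)) := by
        rw [← mul_smul_comm, ← h, pow_succ _ (a + 1), mul_sub, sub_mul]
        simp only [mul_assoc]
        abel
      rw [e1, sub_mul _ ((2 * (a + 1) : ℂ) • _) (x (X k)), mul_sub (x (X k) ^ a),
        ← mul_assoc (x (X k) ^ a) (x (X k)) (y (X k)),
        ← pow_succ, smul_mul_assoc, mul_assoc (x (X k) ^ a) (y (X k))]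
      push_cast
      module
    rw [this]
    refine add_mem (mul_mem ih (x_mem _)) ?_
    rw [← map_pow]
    exact (Subalgebra.smul_mem _ (mul_mem (x_mem _) (R.y_commutator_x_mem k _)) _)

/-- The raising step: modulo lower filtration, bracketing with `∑ y_j²` trades one `x_k` for one
`y_k` in a polarised power sum. -/
theorem laplacian_commutator_powerSum (R : Relations x y ρ c) (a b : ℕ) :
    (∑ j, y (X j) ^ 2) * (∑ k, x (X k) ^ (a + 1) * y (X k) ^ b) -
      (∑ k, x (X k) ^ (a + 1) * y (X k) ^ b) * (∑ j, y (X j) ^ 2) -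
      (2 * (a + 1) : ℂ) • ∑ k, x (X k) ^ a * y (X k) ^ (b + 1) ∈ filt x y ρ b := by
  rw [Finset.mul_sum, Finset.sum_mul, Finset.smul_sum, ← Finset.sum_sub_distrib,
    ← Finset.sum_sub_distrib]
  refine sum_mem fun k _ => ?_
  set E := ∑ j, y (X j) ^ 2 with hE
  have hc : E * y (X k) ^ b = y (X k) ^ b * E := by
    have : E = y (∑ j, X j ^ 2) := by rw [map_sum]; simp [hE]
    rw [this, ← map_pow, ← map_mul, ← map_mul, mul_comm]
  have : E * (x (X k) ^ (a + 1) * y (X k) ^ b) - x (X k) ^ (a + 1) * y (X k) ^ b * E -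
      (2 * (a + 1) : ℂ) • (x (X k) ^ a * y (X k) ^ (b + 1)) =
      (E * x (X k) ^ (a + 1) - x (X k) ^ (a + 1) * E -
        (2 * (a + 1) : ℂ) • (x (X k) ^ a * y (X k))) * y (X k) ^ b := by
    rw [sub_mul, sub_mul, smul_mul_assoc, mul_assoc _ _ (y (X k) ^ b), mul_assoc _ _ (y (X k) ^ b),
      mul_assoc _ _ (y (X k) ^ b), ← pow_succ', mul_assoc _ (y (X k) ^ b), hc]
  rw [this]
  exact Submodule.mul_mem_mul (R.laplacian_commutator_x_pow k a) (y_pow_mem k b)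

/-- Group elements are placed on the left, where the average absorbs them in `filt_le_compress`. -/
theorem degZero_le_span (R : Relations x y ρ c) : (degZero x ρ).toSubmodule ≤ Submodule.span ℂ
    (Set.range fun q : Equiv.Perm (Fin n) × (Fin n →₀ ℕ) => ρ q.1 * x (monomial q.2 1)) := by
  set L := Submodule.span ℂ
    (Set.range fun q : Equiv.Perm (Fin n) × (Fin n →₀ ℕ) => ρ q.1 * x (monomial q.2 1))
  have key : ∀ k ∈ degZero x ρ, ∀ z ∈ L, k * z ∈ L := by
    intro k hk
    induction hk using Algebra.adjoin_induction with
    | mem k hk =>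
      intro z hz
      induction hz using Submodule.span_induction with
      | zero => rw [mul_zero]; exact zero_mem _
      | add t t' _ _ h h' => rw [mul_add]; exact add_mem h h'
      | smul a t _ h => rw [mul_smul_comm]; exact Submodule.smul_mem _ _ h
      | mem z hz =>
        obtain ⟨⟨w, a⟩, rfl⟩ := hz
        rcases hk with ⟨v, rfl⟩ | ⟨i, rfl⟩
        · refine Submodule.subset_span ⟨(v * w, a), ?_⟩
          simp only [map_mul, mul_assoc]
        · refine Submodule.subset_span ⟨(w, Finsupp.single (w⁻¹ i) 1 + a), ?_⟩
          have h1 := R.perm_x w (w⁻¹ i)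
          rw [show w (w⁻¹ i) = i from w.apply_symm_apply i] at h1
          have h2 : (monomial (Finsupp.single (w⁻¹ i) 1 + a) (1 : ℂ)) =
            X (w⁻¹ i) * monomial a 1 := by simp [X]
          simp only [h2, map_mul]
          rw [← mul_assoc, h1, mul_assoc]
    | algebraMap r =>
      intro z hz
      rw [← Algebra.smul_def]
      exact Submodule.smul_mem _ _ hz
    | add a b _ _ ha hb =>
      intro z hz
      rw [add_mul]
      exact add_mem (ha z hz) (hb z hz)
    | mul a b _ _ ha hb =>
      intro z hz
      rw [mul_assoc]
      exact ha _ (hb z hz)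
  intro k hk
  rw [← mul_one k]
  refine key k hk 1 (Submodule.subset_span ⟨(1, 0), ?_⟩)
  simp [show (monomial (0 : Fin n →₀ ℕ) (1 : ℂ)) = 1 from rfl]

theorem degOne_pow_le_span (d : ℕ) : degOne y ^ d ≤ Submodule.span ℂ
    ((fun b : Fin n →₀ ℕ => y (monomial b 1)) '' {b | b.degree ≤ d}) := by
  induction d with
  | zero =>
    rw [pow_zero, Submodule.one_le]
    exact Submodule.subset_span ⟨0, by simp,
      by simp [show (monomial (0 : Fin n →₀ ℕ) (1 : ℂ)) = 1 from rfl]⟩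
  | succ d ih =>
    rw [pow_succ]
    refine (mul_le_mul' ih le_rfl).trans ?_
    rw [degOne, Submodule.span_mul_span, Submodule.span_le]
    rintro _ ⟨_, ⟨b, hb, rfl⟩, _, rfl | ⟨i, rfl⟩, rfl⟩
    · refine Submodule.subset_span ⟨b, Nat.le_succ_of_le hb, ?_⟩
      simp
    · refine Submodule.subset_span ⟨b + Finsupp.single i 1, ?_, ?_⟩
      · simpa using hb
      · simp [monomial_add_single]

/-! ### Averaging over the group, and reduction of symmetrised monomials to power sums. -/

theorem perm_mul_avg (w : Equiv.Perm (Fin n)) : ρ w * avg ρ = avg ρ := by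
  rw [avg, mul_smul_comm, Finset.mul_sum]
  congr 1
  simp only [← map_mul]
  exact Equiv.sum_comp (Equiv.mulLeft w) ρ

theorem avg_mul_perm (w : Equiv.Perm (Fin n)) : avg ρ * ρ w = avg ρ := by
  rw [avg, smul_mul_assoc, Finset.sum_mul]
  congr 1
  simp only [← map_mul]
  exact Equiv.sum_comp (Equiv.mulRight w) ρ

theorem avg_mul_avg : avg ρ * avg ρ = avg ρ := by
  nth_rewrite 1 [avg]
  rw [smul_mul_assoc, Finset.sum_mul]
  simp only [perm_mul_avg, Finset.sum_const, Finset.card_univ]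
  rw [← Nat.cast_smul_eq_nsmul ℂ, smul_smul, one_div, inv_mul_cancel₀, one_smul]
  exact Nat.cast_ne_zero.2 Fintype.card_ne_zero

theorem avg_commute {z : A} (h : ∀ w, ρ w * z = z * ρ w) : avg ρ * z = z * avg ρ := by
  rw [avg, smul_mul_assoc, Finset.sum_mul, mul_smul_comm, Finset.mul_sum]
  simp only [h]

/-- The elements whose compression by the average lies in a given subspace. -/
def compress (ρ : Equiv.Perm (Fin n) →* A) (S : Submodule ℂ A) : Submodule ℂ A :=
  S.comap (LinearMap.mulLeft ℂ (avg ρ) ∘ₗ LinearMap.mulRight ℂ (avg ρ))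

theorem mem_compress {S : Submodule ℂ A} {z : A} :
    z ∈ compress ρ S ↔ avg ρ * (z * avg ρ) ∈ S := Iff.rfl

/-- A `W`-invariant `z` commutes with the average, so compressing a product with `z` as a factor
gives the product of the compressions. -/
theorem mul_mem_compress {S : Submodule ℂ A} (hS : ∀ a ∈ S, ∀ b ∈ S, a * b ∈ S) {z z' : A}
    (hc : ∀ w, ρ w * z = z * ρ w) (h : z ∈ compress ρ S) (h' : z' ∈ compress ρ S) :
    z * z' ∈ compress ρ S ∧ z' * z ∈ compress ρ S := by
  have hz := avg_commute hc
  have hi := avg_mul_avg (ρ := ρ)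
  have e1 : avg ρ * (z * z' * avg ρ) = (avg ρ * (z * avg ρ)) * (avg ρ * (z' * avg ρ)) := by
    rw [← hz, ← mul_assoc (avg ρ) (avg ρ) z, hi, hz, mul_assoc z (avg ρ), ← mul_assoc (avg ρ) (avg ρ),
      hi, ← mul_assoc z, ← hz]
    simp only [mul_assoc]
  have e2 : avg ρ * (z' * z * avg ρ) = (avg ρ * (z' * avg ρ)) * (avg ρ * (z * avg ρ)) := by
    rw [← hz, ← mul_assoc (avg ρ) (avg ρ) z, hi, mul_assoc (avg ρ), mul_assoc z' (avg ρ),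
      ← mul_assoc (avg ρ) (avg ρ) z, hi, mul_assoc z' z, hz]
  rw [mem_compress, mem_compress, e1, e2]
  exact ⟨hS _ h _ h', hS _ h' _ h⟩

theorem sum_perm_commute (R : Relations x y ρ c) (a b : ℕ) (w : Equiv.Perm (Fin n)) :
    ρ w * ∑ k, x (X k) ^ a * y (X k) ^ b = (∑ k, x (X k) ^ a * y (X k) ^ b) * ρ w := by
  rw [Finset.mul_sum, Finset.sum_mul,
    ← Equiv.sum_comp w fun k => x (X k) ^ a * y (X k) ^ b * ρ w]
  refine Finset.sum_congr rfl fun k _ => ?_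
  rw [← map_pow, ← map_pow, ← mul_assoc, R.perm_mul_x, mul_assoc, R.perm_mul_y, ← mul_assoc]
  simp

theorem filt_le_compress (R : Relations x y ρ c) {S : Submodule ℂ A} {d : ℕ}
    (h : ∀ a b : Fin n →₀ ℕ, b.degree ≤ d → x (monomial a 1) * y (monomial b 1) ∈ compress ρ S) :
    filt x y ρ d ≤ compress ρ S := by
  refine (mul_le_mul' R.degZero_le_span (degOne_pow_le_span d)).trans ?_
  rw [Submodule.span_mul_span, Submodule.span_le]
  rintro _ ⟨_, ⟨⟨w, a⟩, rfl⟩, _, ⟨b, hb, rfl⟩, rfl⟩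
  have := h a b hb
  rw [mem_compress] at this
  change avg ρ * (ρ w * x (monomial a 1) * y (monomial b 1) * avg ρ) ∈ S
  rw [mul_assoc (ρ w), mul_assoc (ρ w), ← mul_assoc (avg ρ), avg_mul_perm]
  exact this

/-- The polarised power sums of degree at most `d` in the `y_i`, given the lower filtration
steps. -/
theorem powerSum_mem (R : Relations x y ρ c) {S : Submodule ℂ A}
    (hS : ∀ a ∈ S, ∀ b ∈ S, a * b ∈ S)
    (hx : ∀ a : ℕ, ∑ k, x (X k) ^ a ∈ compress ρ S)
    (hy : ∑ k, y (X k) ^ 2 ∈ compress ρ S) {d : ℕ}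
    (hd : ∀ d' < d, filt x y ρ d' ≤ compress ρ S) :
    ∀ b ≤ d, ∀ a, ∑ k, x (X k) ^ a * y (X k) ^ b ∈ compress ρ S := by
  intro b
  induction b with
  | zero =>
    intro _ a
    simpa using hx a
  | succ b ih =>
    intro hb a
    have hE : ∀ w, ρ w * ∑ k, y (X k) ^ 2 = (∑ k, y (X k) ^ 2) * ρ w := fun w => by
      simpa using R.sum_perm_commute 0 2 w
    -- To reach exponent `b + 1` in `y`, bracket the sum with exponents `(a + 1, b)` with `∑ y_k²`;
    -- the error has degree `b < d`, and the coefficient `2(a + 1)` is invertible.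
    have h1 := mul_mem_compress hS hE hy (ih (by omega) (a + 1))
    have h2 := hd b (by omega) (R.laplacian_commutator_powerSum a b)
    have h3 := sub_mem (sub_mem h1.1 h1.2) h2
    rw [sub_sub_cancel] at h3
    refine (Submodule.smul_mem_iff _ ?_).1 h3
    exact mul_ne_zero two_ne_zero (Nat.cast_add_one_ne_zero a)

theorem perm_mul_monomial (R : Relations x y ρ c) {a b : Fin n →₀ ℕ} {i k : Fin n}
    (hi : i ∉ a.support ∪ b.support) (hk : k ∉ a.support ∪ b.support) (r s : ℕ) :
    ρ (Equiv.swap i k) *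
      (x (monomial (a + Finsupp.single i r) 1) * y (monomial (b + Finsupp.single i s) 1)) =
    x (monomial (a + Finsupp.single k r) 1) * y (monomial (b + Finsupp.single k s) 1) *
      ρ (Equiv.swap i k) := by
  have h : ∀ f : Fin n →₀ ℕ, i ∉ f.support → k ∉ f.support → ∀ r : ℕ,
      rename (Equiv.swap i k) (monomial (f + Finsupp.single i r) (1 : ℂ)) =
        monomial (f + Finsupp.single k r) 1 := by
    intro f hi hk r
    have hf : Finsupp.mapDomain (Equiv.swap i k) f = f := by
      refine (Finsupp.mapDomain_congr (g := id) fun j hj => ?_).trans Finsupp.mapDomain_id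
      exact Equiv.swap_apply_of_ne_of_ne (fun h => hi (h ▸ hj)) (fun h => hk (h ▸ hj))
    rw [rename_monomial, Finsupp.mapDomain_add, hf, Finsupp.mapDomain_single,
      Equiv.swap_apply_left]
  simp only [Finset.mem_union, not_or] at hi hk
  rw [← mul_assoc, R.perm_mul_x, mul_assoc, R.perm_mul_y, h a hi.1 hk.1, h b hi.2 hk.2, mul_assoc]

/-- Induction on the number of indices that occur. Split off one index `i`: up to lower filtration,
a power sum times the remaining monomial is `∑ m k`, where `m k` is the original monomial with `i`
replaced by `k`. -/
theorem monomial_mem (R : Relations x y ρ c) {S : Submodule ℂ A}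
    (hS : ∀ a ∈ S, ∀ b ∈ S, a * b ∈ S) (h1 : avg ρ ∈ S) {d : ℕ}
    (hd : ∀ d' < d, filt x y ρ d' ≤ compress ρ S)
    (hp : ∀ b ≤ d, ∀ a, ∑ k, x (X k) ^ a * y (X k) ^ b ∈ compress ρ S) (r : ℕ) :
    ∀ a b : Fin n →₀ ℕ, (a.support ∪ b.support).card ≤ r → b.degree ≤ d →
      x (monomial a 1) * y (monomial b 1) ∈ compress ρ S := by
  induction r with
  | zero =>
    intro a b hr _
    rw [Nat.le_zero, Finset.card_eq_zero, Finset.union_eq_empty, Finsupp.support_eq_empty,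
      Finsupp.support_eq_empty] at hr
    rw [hr.1, hr.2, show (monomial (0 : Fin n →₀ ℕ) (1 : ℂ)) = 1 from rfl, map_one, map_one,
      mem_compress, one_mul, one_mul, avg_mul_avg]
    exact h1
  | succ r ih =>
    intro a b hr hb
    rcases (a.support ∪ b.support).eq_empty_or_nonempty with h0 | ⟨i, hi⟩
    · exact ih a b (by rw [h0]; simp) hb
    set a' := a.erase i with ha'
    set b' := b.erase i with hb'
    set s := a i with hs
    set t := b i with ht
    have haa : a' + Finsupp.single i s = a := Finsupp.erase_add_single i a
    have hbb : b' + Finsupp.single i t = b := Finsupp.erase_add_single i b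
    set σ := a'.support ∪ b'.support with hσ
    have hiσ : i ∉ σ := by simp [hσ, ha', hb']
    have hσr : σ.card ≤ r := by
      have : insert i σ ⊆ a.support ∪ b.support := by
        intro j hj
        rcases Finset.mem_insert.1 hj with rfl | hj
        · exact hi
        · simp only [hσ, ha', hb', Finset.mem_union, Finsupp.support_erase,
            Finset.mem_erase] at hj
          exact Finset.mem_union.2 (hj.imp And.right And.right)
      have := Finset.card_le_card this
      rw [Finset.card_insert_of_notMem hiσ] at this
      omega
    have hdeg : b'.degree + t ≤ d := by
      rw [← hbb, map_add, Finsupp.degree_single] at hb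
      exact hb
    set m : Fin n → A := fun k =>
      x (monomial (a' + Finsupp.single k s) 1) * y (monomial (b' + Finsupp.single k t) 1) with hm
    -- An index already present in the remaining monomial creates no new one, so the induction
    -- hypothesis applies.
    have hmσ : ∀ k ∈ σ, m k ∈ compress ρ S := by
      intro k hk
      refine ih _ _ (le_trans (Finset.card_le_card ?_) hσr) ?_
      · intro j hj
        rcases eq_or_ne j k with rfl | hjk
        · exact hk
        · simpa [hσ, hjk] using hj
      · rw [map_add, Finsupp.degree_single]
        exact hdeg
    -- For fresh indices `m k` and `m i` are conjugate under a transposition, hence have equal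
    -- compressions.
    have hmi : ∀ k ∉ σ, m k - m i ∈ compress ρ S := by
      intro k hk
      have h := R.perm_mul_monomial (a := a') (b := b') hiσ hk s t
      have h2 : avg ρ * (m k * avg ρ) = avg ρ * (m i * avg ρ) := by
        calc avg ρ * (m k * avg ρ) = avg ρ * (m k * ρ (Equiv.swap i k) * avg ρ) := by
              rw [mul_assoc (m k), perm_mul_avg]
          _ = avg ρ * (ρ (Equiv.swap i k) * m i * avg ρ) := by rw [h]
          _ = _ := by rw [mul_assoc (ρ _), ← mul_assoc (avg ρ), avg_mul_perm]
      rw [mem_compress, sub_mul, mul_sub, h2, sub_self]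
      exact zero_mem _
    have hprod : (∑ k, x (X k) ^ s * y (X k) ^ t) * (x (monomial a' 1) * y (monomial b' 1)) ∈
        compress ρ S :=
      (mul_mem_compress hS (R.sum_perm_commute s t) (hp t (by omega) s)
        (ih a' b' hσr (by omega))).1
    have herr : ∀ k, x (X k) ^ s * y (X k) ^ t * (x (monomial a' 1) * y (monomial b' 1)) - m k ∈
        compress ρ S := by
      intro k
      have e : x (X k) ^ s * y (X k) ^ t * (x (monomial a' 1) * y (monomial b' 1)) - m k =
          x (X k ^ s) * ((y (X k) ^ t * x (monomial a' 1) - x (monomial a' 1) * y (X k) ^ t) *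
            y (monomial b' 1)) := by
        simp only [hm]
        rw [monomial_add_single, monomial_add_single, mul_comm (monomial a' (1 : ℂ)),
          mul_comm (monomial b' (1 : ℂ)), map_mul, map_mul, map_pow, map_pow]
        noncomm_ring
      rw [e]
      -- With `t = 0` no reordering is needed; with `t = u + 1` the commutator loses one degree, so
      -- the error lies in degree `u + b'.degree < d`.
      cases ht0 : t with
      | zero =>
        rw [pow_zero, one_mul, mul_one, sub_self, zero_mul, mul_zero]
        exact zero_mem _
      | succ u =>
        refine hd (0 + (u + b'.degree)) (by omega) ?_
        exact R.mul_mem_filt (mem_filt_of_degZero (x_mem _) 0)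
          (R.mul_mem_filt (R.y_pow_commutator_x_mem k u _) (mem_filt_of_pow (y_monomial_mem b')))
    have hsum : ∑ k, m k ∈ compress ρ S := by
      have := sub_mem hprod (sum_mem fun k (_ : k ∈ Finset.univ) => herr k)
      rwa [Finset.sum_sub_distrib, ← Finset.sum_mul, sub_sub_cancel] at this
    rw [← Finset.sum_add_sum_compl σ] at hsum
    have h3 := (Submodule.add_mem_iff_right _ (sum_mem hmσ)).1 hsum
    have h4 := sub_mem h3 (sum_mem fun k (hk : k ∈ σᶜ) => hmi k (Finset.mem_compl.1 hk))
    -- What is left is `m i` times the size of the complement of `σ`, nonzero since `i` belongs to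
    -- that complement.
    rw [Finset.sum_sub_distrib, sub_sub_cancel, Finset.sum_const, ← Nat.cast_smul_eq_nsmul ℂ] at h4
    have h5 := (Submodule.smul_mem_iff _ (Nat.cast_ne_zero.2
      (Finset.card_ne_zero.2 ⟨i, Finset.mem_compl.2 hiσ⟩))).1 h4
    simp only [hm, haa, hbb] at h5
    exact h5

/-- The spherical subalgebra is generated by the power sums of the `x_i` and by `∑ y_i²`. -/
theorem spherical_mem (R : Relations x y ρ c) {S : Submodule ℂ A}
    (hS : ∀ a ∈ S, ∀ b ∈ S, a * b ∈ S) (h1 : avg ρ ∈ S)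
    (hx : ∀ a : ℕ, ∑ k, x (X k) ^ a ∈ compress ρ S)
    (hy : ∑ k, y (X k) ^ 2 ∈ compress ρ S) {z : A} (hz : z ∈ Algebra.adjoin ℂ
    (Set.range ρ ∪ (Set.range fun i => x (X i)) ∪ Set.range fun i => y (X i))) :
    z ∈ compress ρ S := by
  obtain ⟨d, hd⟩ := R.exists_mem_filt hz
  suffices h : ∀ d, filt x y ρ d ≤ compress ρ S from h d hd
  intro d
  induction d using Nat.strong_induction_on with
  | _ d ih =>
    exact R.filt_le_compress fun a b hb =>
      R.monomial_mem hS h1 ih (R.powerSum_mem hS hx hy ih) _ a b le_rfl hb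

end Relations

end Cherednik

/-! ### Images of `U_c` and of the bimodules `P` under the sign twist. -/

namespace Cherednik

variable {n : ℕ}

open scoped IsMulCommutative in
/-- Polynomials in the Dunkl operators. -/
theorem exists_dunklHom (n : ℕ) (c : ℂ) : ∃ y : MvPolynomial (Fin n) ℂ →ₐ[ℂ] HReg n,
    ∀ i, y (MvPolynomial.X i) = dunkl n c i := by
  have : IsMulCommutative (Algebra.adjoin ℂ (Set.range (dunkl n c))) :=
    Algebra.isMulCommutative_adjoin ℂ (by
      rintro _ ⟨i, rfl⟩ _ ⟨j, rfl⟩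
      exact dunkl_commute c i j)
  refine ⟨(Algebra.adjoin ℂ (Set.range (dunkl n c))).val.comp
    (MvPolynomial.aeval fun i => ⟨dunkl n c i, Algebra.subset_adjoin ⟨i, rfl⟩⟩), fun i => ?_⟩
  rw [AlgHom.comp_apply, MvPolynomial.aeval_X]
  rfl

/-- Polynomial functions as elements of the skew group ring. -/
def polyHom (n : ℕ) : MvPolynomial (Fin n) ℂ →ₐ[ℂ] HReg n :=
  (fnHom n).comp (IsScalarTower.toAlgHom ℂ (MvPolynomial (Fin n) ℂ) (RegFun n))

theorem polyHom_X (i : Fin n) : polyHom n (MvPolynomial.X i) = fn (coord n i) := rfl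

theorem relations {c : ℂ} {y : MvPolynomial (Fin n) ℂ →ₐ[ℂ] HReg n}
    (hy : ∀ i, y (MvPolynomial.X i) = dunkl n c i) :
    Relations (polyHom n) y (permMonoidHom n) c where
  perm_x w i := by
    rw [polyHom_X, polyHom_X, ← permHom_coord]
    exact perm_mul_fn w _
  perm_y w i := by
    rw [hy, hy]
    exact perm_mul_dunkl c w i
  comm_ne h := by
    rw [hy, polyHom_X]
    exact dunkl_commutator_coord_of_ne c h
  comm_self i := by
    rw [hy, polyHom_X]
    exact dunkl_commutator_coord_self c i

theorem avg_permMonoidHom : Relations.avg (permMonoidHom n) = e n := rfl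

theorem perm_mul_e (w : Equiv.Perm (Fin n)) : perm w * e n = e n :=
  Relations.perm_mul_avg (ρ := permMonoidHom n) w

theorem e_mul_e : e n * e n = e n := Relations.avg_mul_avg (ρ := permMonoidHom n)

theorem dunkl_mul_e (c : ℂ) (i : Fin n) : dunkl n c i * e n = del n i * e n := by
  have h : ∀ k, fn (invDiff i k) * (1 - perm (Equiv.swap i k)) * e n = 0 := fun k => by
    rw [mul_assoc, sub_mul, perm_mul_e, one_mul, sub_self, mul_zero]
  rw [dunkl_eq, sub_mul, smul_mul_assoc, Finset.sum_mul]
  simp only [h, Finset.sum_const_zero, smul_zero, sub_zero]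

/-- The Calogero–Moser operator, the radial part of the Dunkl Laplacian. -/
def calogeroMoser (n : ℕ) (c : ℂ) : HReg n :=
  ∑ i, del n i * del n i - (2 * c) • ∑ i, fn (logDer i) * del n i

/-- On `e` the inner Dunkl operator is `∂_i`, and `s_{ik} ∂_i e = ∂_k e`; exchanging `i` and `k` in
the double sum doubles the first-order term. -/
theorem sum_dunkl_sq_mul_e (c : ℂ) :
    (∑ i, dunkl n c i ^ 2) * e n = calogeroMoser n c * e n := by
  have h1 : ∀ i k, fn (invDiff i k) * (1 - perm (Equiv.swap i k)) * (del n i * e n) =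
      fn (invDiff i k) * del n i * e n + fn (invDiff k i) * del n k * e n := by
    intro i k
    rw [invDiff_swap i k, fn_neg, mul_assoc, sub_mul, ← mul_assoc (perm _), perm_mul_del,
      Equiv.swap_apply_left, mul_assoc (del n k), perm_mul_e]
    noncomm_ring
  have h2 : ∀ i, dunkl n c i ^ 2 * e n = del n i * del n i * e n -
      c • ((∑ k, fn (invDiff i k) * del n i * e n) + ∑ k, fn (invDiff k i) * del n k * e n) := by
    intro i
    rw [pow_two, mul_assoc, dunkl_mul_e, dunkl_eq, sub_mul, smul_mul_assoc, Finset.sum_mul]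
    simp only [h1, Finset.sum_add_distrib, mul_assoc]
  rw [Finset.sum_mul]
  simp only [h2, calogeroMoser, sub_mul, smul_mul_assoc, Finset.sum_sub_distrib, Finset.sum_mul,
    ← Finset.smul_sum, Finset.sum_add_distrib, logDer, fn_sum]
  rw [Finset.sum_comm (f := fun i k => fn (invDiff k i) * del n k * e n)]
  module

theorem signTwistHom_e (c : ℂ) : signTwistHom n c (e n) = conjDisc n 1 (e n) := by
  simp only [e, map_smul, map_sum, signTwistHom_perm, conjDisc_one_perm]

/-- The second- and first-order parts agree on the nose; the functions differ by `(2c + 1) ∑ (∂_i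
ℓ_i + ℓ_i²)`, zero by harmonicity of `δ`. -/
theorem signTwistHom_calogeroMoser (c : ℂ) :
    signTwistHom n (c + 1) (calogeroMoser n c) = conjDisc n 1 (calogeroMoser n (-c - 1)) := by
  have h : ∀ (a b : ℂ) (i : Fin n), (del n i + b • fn (logDer i)) * (del n i + b • fn (logDer i)) -
      (2 * a) • (fn (logDer i) * (del n i + b • fn (logDer i))) =
      del n i * del n i + (2 * b - 2 * a) • (fn (logDer i) * del n i) +
        b • fn (partialDer n i (logDer i)) +
        (b * b - 2 * a * b) • fn (logDer i * logDer i) := by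
    intro a b i
    have := del_mul_fn (n := n) i (logDer i)
    simp only [mul_add, add_mul, smul_mul_assoc, mul_smul_comm, this, fn_mul]
    module
  have h0 : ∑ i : Fin n, (fn (partialDer n i (logDer i)) + fn (logDer i * logDer i) : HReg n) =
      0 := by
    simp only [← fn_add, ← fn_sum, sum_partialDer_logDer, fn_zero]
  have hb : ∀ i : Fin n, conjDisc n 1 (del n i) = del n i + (1 : ℂ) • fn (logDer i) := fun i => by
    rw [conjDisc_one_del, one_smul]
  simp only [calogeroMoser, map_sub, map_sum, map_smul, map_mul, signTwistHom_del,
    signTwistHom_fn, hb, conjDisc_fn, Finset.smul_sum, ← Finset.sum_sub_distrib, h]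
  rw [← sub_eq_zero, ← Finset.sum_sub_distrib]
  calc _ = ∑ i : Fin n, (2 * c + 1) •
        (fn (partialDer n i (logDer i)) + fn (logDer i * logDer i) : HReg n) :=
        Finset.sum_congr rfl fun i _ => by module
    _ = 0 := by rw [← Finset.smul_sum, h0, smul_zero]

theorem mem_U {c : ℂ} {z : HReg n} : z ∈ U n c ↔ ∃ h ∈ H n c, e n * (h * e n) = z := Iff.rfl

theorem e_mem_H (c : ℂ) : e n ∈ H n c :=
  Subalgebra.smul_mem _ (sum_mem fun w _ => perm_mem_H c w) _

theorem mul_mem_U {c : ℂ} {z z' : HReg n} (h : z ∈ U n c) (h' : z' ∈ U n c) :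
    z * z' ∈ U n c := by
  obtain ⟨a, ha, rfl⟩ := mem_U.1 h
  obtain ⟨b, hb, rfl⟩ := mem_U.1 h'
  refine mem_U.2 ⟨a * e n * (e n * b), mul_mem (mul_mem ha (e_mem_H c)) (mul_mem (e_mem_H c) hb), ?_⟩
  simp only [mul_assoc]

/-- Two homomorphisms are compared on generators of the spherical subalgebras. The hypotheses are
symmetric, so applying it in both directions gives equality in `map_U`. -/
theorem map_U_le {a b : ℂ} {F G : HReg n →ₐ[ℂ] HReg n} (he : F (e n) = G (e n))
    (hf : ∀ f : RegFun n, F (fn f) = G (fn f))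
    (hL : F (calogeroMoser n a) = G (calogeroMoser n b)) :
    (U n a).map F.toLinearMap ≤ (U n b).map G.toLinearMap := by
  obtain ⟨y, hy⟩ := exists_dunklHom n a
  have R := relations hy
  -- `S` is closed under products, so by `Relations.spherical_mem` it contains `U_a` once it
  -- contains the generators.
  set S := ((U n b).map G.toLinearMap).comap F.toLinearMap
  have hmem : ∀ z h, h ∈ H n b → F z = G (e n * (h * e n)) → z ∈ S := fun z h hh hz =>
    ⟨_, mem_U.2 ⟨h, hh, rfl⟩, hz.symm⟩
  have hS : ∀ z ∈ S, ∀ z' ∈ S, z * z' ∈ S := by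
    rintro z ⟨u, hu, huz⟩ z' ⟨u', hu', huz'⟩
    refine ⟨u * u', mul_mem_U hu hu', ?_⟩
    simp only [AlgHom.toLinearMap_apply] at huz huz' ⊢
    rw [map_mul, map_mul, huz, huz']
  have h1 : Relations.avg (permMonoidHom n) ∈ S :=
    hmem _ 1 (one_mem _) (by rw [one_mul, e_mul_e, avg_permMonoidHom, he])
  have hx : ∀ k : ℕ, ∑ i, polyHom n (MvPolynomial.X i) ^ k ∈
      Relations.compress (permMonoidHom n) S := by
    intro k
    have hk : ∑ i, polyHom n (MvPolynomial.X i) ^ k = fn (∑ i, coord n i ^ k) := by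
      simp only [polyHom_X, ← fnHom_apply, map_sum, map_pow]
    refine hmem _ (∑ i, polyHom n (MvPolynomial.X i) ^ k)
      (sum_mem fun i _ => pow_mem (coord_mem_H b i) k) ?_
    rw [hk]
    change F (e n * (fn _ * e n)) = _
    rw [map_mul, map_mul, map_mul, map_mul, he, hf]
  have hE : ∑ i, y (MvPolynomial.X i) ^ 2 ∈ Relations.compress (permMonoidHom n) S := by
    refine hmem _ (∑ i, dunkl n b i ^ 2) (sum_mem fun i _ => pow_mem (dunkl_mem_H b i) 2) ?_
    simp only [hy]
    change F (e n * ((∑ i, dunkl n a i ^ 2) * e n)) = _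
    rw [sum_dunkl_sq_mul_e, sum_dunkl_sq_mul_e, map_mul, map_mul, map_mul,
      map_mul, he, hL]
  rintro _ ⟨z, hz, rfl⟩
  obtain ⟨h, hh, rfl⟩ := mem_U.1 hz
  refine R.spherical_mem hS h1 hx hE (z := h) ?_
  simp only [hy]
  exact hh

theorem conjDisc_map (k : ℤ) (S : Submodule ℂ (HReg n)) :
    S.map (conjDisc n k).toLinearMap = sandwich (discPow n (-k)) S (discPow n k) := by
  rw [sandwich]
  congr 1
  refine LinearMap.ext fun z => ?_
  exact mul_assoc _ _ _

theorem map_U (c : ℂ) : (U n c).map (signTwistHom n (c + 1)).toLinearMap =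
    sandwich (discPow n (-1)) (U n (-c - 1)) (discPow n 1) := by
  rw [← conjDisc_map]
  exact le_antisymm
    (map_U_le (signTwistHom_e _) (fun f => by simp) (signTwistHom_calogeroMoser c))
    (map_U_le (signTwistHom_e _).symm (fun f => by simp) (signTwistHom_calogeroMoser c).symm)

theorem mem_sandwich {a b z : HReg n} {S : Submodule ℂ (HReg n)} :
    z ∈ sandwich a S b ↔ ∃ s ∈ S, a * (s * b) = z := Iff.rfl

theorem sandwich_mul_sandwich {a b b' d : HReg n} (h : b * b' = 1) (S T : Submodule ℂ (HReg n)) :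
    sandwich a S b * sandwich b' T d = sandwich a (S * T) d := by
  have key : ∀ s t : HReg n, a * (s * b) * (b' * (t * d)) = a * (s * t * d) := fun s t => by
    rw [mul_assoc a, mul_assoc s, ← mul_assoc b, h, one_mul, mul_assoc s]
  apply le_antisymm
  · rw [Submodule.mul_le]
    intro z hz z' hz'
    obtain ⟨s, hs, rfl⟩ := mem_sandwich.1 hz
    obtain ⟨t, ht, rfl⟩ := mem_sandwich.1 hz'
    rw [mem_sandwich]
    exact ⟨s * t, Submodule.mul_mem_mul hs ht, (key s t).symm⟩
  · intro z hz
    obtain ⟨r, hr, rfl⟩ := mem_sandwich.1 hz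
    induction hr using Submodule.mul_induction_on' with
    | mem_mul_mem s hs t ht =>
      rw [← key]
      exact Submodule.mul_mem_mul (mem_sandwich.2 ⟨s, hs, rfl⟩) (mem_sandwich.2 ⟨t, ht, rfl⟩)
    | add r hr r' hr' h h' =>
      rw [add_mul, mul_add]
      exact add_mem (h (mem_sandwich.2 ⟨r, hr, rfl⟩)) (h' (mem_sandwich.2 ⟨r', hr', rfl⟩))

theorem sandwich_sandwich (a b a' b' : HReg n) (S : Submodule ℂ (HReg n)) :
    sandwich a (sandwich a' S b') b = sandwich (a * a') S (b' * b) := by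
  rw [sandwich, sandwich, sandwich, ← Submodule.map_comp]
  congr 1
  refine LinearMap.ext fun z => ?_
  change a * (a' * (z * b') * b) = a * a' * (z * (b' * b))
  simp only [mul_assoc]

/-- Both are the sign idempotent, since `δ` is `W`-anti-invariant. -/
theorem conjDisc_neg_one_e : conjDisc n (-1) (e n) = conjDisc n 1 (e n) := by
  have h : ∀ w : Equiv.Perm (Fin n), conjDisc n (-1) (perm w) = sgn w • perm w := fun w => by
    have hw : (perm w : HReg n) = sgn w • conjDisc n 1 (perm w) := by
      rw [conjDisc_one_perm, smul_smul, sgn_mul_self, one_smul]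
    conv_lhs => rw [hw, map_smul, conjDisc_conjDisc, neg_add_cancel, conjDisc_zero]
  simp only [e, map_smul, map_sum, h, conjDisc_one_perm]

/-- The sign idempotent is written as `δ e δ⁻¹` on the left and as `δ⁻¹ e δ` on the right; the
right-hand `δ⁻¹` cancels the `δ` in `e H_a δ e`. -/
theorem map_POne (a : ℂ) : (POne n a).map (signTwistHom n a).toLinearMap =
    sandwich (discPow n 1) (QOne n (-a)) (discPow n 1) := by
  have h1 : signTwistHom n a (e n) = discPow n 1 * e n * discPow n (-1) := by
    rw [signTwistHom_e, ← conjDisc_neg_one_e, conjDisc_apply, neg_neg]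
  have h2 : signTwistHom n a (e n) = discPow n (-1) * e n * discPow n 1 := by
    rw [signTwistHom_e, conjDisc_apply]
  have h3 : ((signTwistHom n a).toLinearMap ∘ₗ
      (LinearMap.mulLeft ℂ (e n) ∘ₗ LinearMap.mulRight ℂ (discPow n 1 * e n))) =
      (LinearMap.mulLeft ℂ (discPow n 1 * (e n * discPow n (-1))) ∘ₗ
        LinearMap.mulRight ℂ (e n * discPow n 1)) ∘ₗ (signTwistHom n a).toLinearMap := by
    refine LinearMap.ext fun z => ?_
    change signTwistHom n a (e n * (z * (discPow n 1 * e n))) =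
      discPow n 1 * (e n * discPow n (-1)) * (signTwistHom n a z * (e n * discPow n 1))
    have h4 : discPow n 1 * (discPow n (-1) * (e n * discPow n 1)) = e n * discPow n 1 := by
      rw [← mul_assoc, discPow_mul_cancel (by ring), one_mul]
    rw [map_mul, map_mul, map_mul, signTwistHom_discPow]
    nth_rewrite 1 [h1]
    rw [h2]
    simp only [mul_assoc, h4]
  rw [QOne, sandwich_sandwich, POne, sandwich, sandwich, ← Submodule.map_comp, h3,
    Submodule.map_comp, ← map_H a]
  rfl

theorem map_P (c : ℂ) (j : ℕ) : (P n c (j + 1)).map (signTwistHom n (c + 1)).toLinearMap =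
    sandwich (discPow n (2 * ((j + 1 : ℕ) : ℤ) - 1)) (Q n (-c - ((j + 1 : ℕ) : ℂ) - 1) (j + 1))
      (discPow n 1) := by
  induction j with
  | zero =>
    rw [zero_add, P, Q, map_POne]
    congr 2
    push_cast
    ring
  | succ j ih =>
    have h1 : (POne n (c + (j + 2))).map (signTwistHom n (c + 1)).toLinearMap =
        sandwich (discPow n (2 * (j + 1) + 1)) (QOne n (-(c + (j + 2))))
          (discPow n (1 - 2 * (j + 1))) := by
      -- `map_POne` needs the twist at `c + j + 2`; passing from there to `c + 1` costs `j + 1`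
      -- conjugations by `δ⁻²`.
      have h2 : signTwistHom n (c + 1) =
          (conjDisc n (-(2 * (j + 1)))).comp (signTwistHom n (c + (j + 2))) := by
        refine AlgHom.ext fun z => ?_
        have := signTwistHom_add_natCast (c + 1) (j + 1) z
        rw [AlgHom.comp_apply, show c + ((j : ℂ) + 2) = c + 1 + ((j + 1 : ℕ) : ℂ) by push_cast; ring,
          this, conjDisc_conjDisc]
        push_cast
        rw [neg_add_cancel, conjDisc_zero]
      rw [h2, AlgHom.comp_toLinearMap, Submodule.map_comp, map_POne, conjDisc_map,
        sandwich_sandwich, ← discPow_add, ← discPow_add, neg_neg, sub_eq_add_neg]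
    have e1 : (2 * (j + 1) + 1 : ℤ) = 2 * ((j + 1 + 1 : ℕ) : ℤ) - 1 := by push_cast; ring
    have e2 : -(c + (j + 2)) = -c - ((j + 1 + 1 : ℕ) : ℂ) - 1 + 1 := by push_cast; ring
    have e3 : -c - ((j + 1 : ℕ) : ℂ) - 1 = -c - ((j + 1 + 1 : ℕ) : ℂ) - 1 + 1 := by
      push_cast; ring
    -- The powers of `δ` between the new factor and the inductive one cancel. Negating parameters
    -- sends the top factor of `P` to the bottom factor of `Q`, so the two recursions match.
    have e4 : discPow n (1 - 2 * (j + 1)) * discPow n (2 * ((j + 1 : ℕ) : ℤ) - 1) = 1 :=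
      discPow_mul_cancel (by push_cast; ring)
    rw [e1, e2] at h1
    rw [P, Submodule.map_mul, ih, h1, sandwich_mul_sandwich e4, e3, Q]

end Cherednik

theorem lemma5p6 (n : ℕ) (hn : 2 ≤ n) :
    ∃ φ : ℂ → (Cherednik.HReg n ≃ₐ[ℂ] Cherednik.HReg n),
      (∀ c : ℂ, ∀ ψ : Cherednik.HReg n →ₐ[ℂ] Cherednik.HReg n,
        Cherednik.IsSignTwist c ψ ↔ ψ = (φ c : Cherednik.HReg n →ₐ[ℂ] Cherednik.HReg n)) ∧
      (∀ c : ℂ, (Cherednik.H n c).map (φ c : Cherednik.HReg n →ₐ[ℂ] Cherednik.HReg n) =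
        Cherednik.H n (-c)) ∧
      ∀ c : ℂ,
        (∀ z ∈ Cherednik.UReg n,
          φ (c + 1) z = Cherednik.discPow n (-2) * φ c z * Cherednik.discPow n 2) ∧
        (Cherednik.U n c).map (φ (c + 1)).toLinearMap =
          Cherednik.sandwich (Cherednik.discPow n (-1)) (Cherednik.U n (-c - 1))
            (Cherednik.discPow n 1) ∧
        ∀ j : ℕ, 0 < j →
          (Cherednik.P n c j).map (φ (c + 1)).toLinearMap =
            Cherednik.sandwich (Cherednik.discPow n (2 * (j : ℤ) - 1))
              (Cherednik.Q n (-c - (j : ℂ) - 1) j) (Cherednik.discPow n 1) := by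
  refine ⟨Cherednik.signTwist n, fun c ψ => ⟨fun h => h.eq, ?_⟩, fun c => Cherednik.map_H c,
    fun c => ⟨fun z _ => ?_, Cherednik.map_U c, fun j hj => ?_⟩⟩
  · rintro rfl
    exact Cherednik.isSignTwist_signTwistHom c
  · exact DFunLike.congr_fun (Cherednik.signTwistHom_add_one c) z
  · obtain ⟨j, rfl⟩ := Nat.exists_eq_succ_of_ne_zero hj.ne'
    exact Cherednik.map_P c j

end
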